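/- **Setting.** On $\mathbb C^7$ let $\langle x,y\rangle=\sum_i x_iy_i$, let $\perp$ denote the orthogonal complement with respect to $\langle\cdot,\cdot\rangle$, let bars denote complex conjugation, and for a subspace $W$ let $\pi_W$ be the Hermitian orthogonal projection onto $W$. Identify $\mathbb C^7=\operatorname{Im}(\mathbb O)\otimes\mathbb C$, where the octonions have the imaginary units $e_1,\dots,e_7$ with $e_i^2=-1$, $e_ie_j=-e_je_i$ for $i\neq j$, and $e_ie_j=e_k,\ e_je_k=e_i,\ e_ke_i=e_j$ for $(i,j,k)\in\{(1,5,2),(1,6,3),(1,7,4),(2,7,3),(3,5,4),(4,6,2),(5,6,7)\}$; write $x\cdot y\in\mathbb C^7$ for the imaginary part of the octonion product. Let $\mathbb G_2\subset \mathrm{SO}(7,\mathbb C)$ be the automorphism group of $\mathbb O\otimes\mathbb C$, acting on $\mathbb C^7$. Let $\mathcal L_-^\tau(\mathbb G_2,\mathbb C^7)$ be the set of rational maps $g$ from $\mathbb{CP}^1$ to the complex $7\times7$ matrices that take values in $\mathbb G_2$ on an open dense set, satisfy $\overline{g(\bar\lambda)}=g(\lambda)$, and are holomorphic at $\infty$ with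 $g(\infty)=\mathrm{Id}$. Such a $g$ is *holomorphic at* $z$ if it has no pole at $z$ and $g(z)\in\mathbb G_2$ (and similarly with $\mathrm{SO}(7,\mathbb C)$ instead of $\mathbb G_2$). A line or subspace is *isotropic* if $\langle\cdot,\cdot\rangle$ vanishes on it; a *complex coassociative plane* is an isotropic $2$-plane $\mathcal C\subset\mathbb C^7$ with $\mathcal C\cdot\mathcal C=0$. A pair $(L,K)$ of isotropic lines *satisfies the $\mathbb G_2$ pair condition* if $$K\subset\overline L^{\perp}\quad\text{and}\quad L\oplus\pi_{(L\oplus\overline L)^\perp}K\ \text{ is complex coassociative.}$$ For $\alpha\in\mathbb C\setminus\mathbb R$ and isotropic lines $L,K$ put $$p_{\alpha,L}(\lambda)=\frac{\lambda-\bar\alpha}{\lambda-\alpha}\,\pi_{\overline L}+\pi_{(L\oplus\overline L)^\perp}+\frac{\lambda-\alpha}{\lambda-\bar\alpha}\,\pi_L,\qquad p_{\alpha,L,K}=p_{\alpha,L}\,p_{\alpha,K}.$$ **Proposition.** Let $\alpha\in\mathbb C\setminus\mathbb R$, let $(L,K)$ be a pair of isotropic lines satisfying the $\mathbb G_2$ pair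 condition, and let $h\in\mathcal L_-^\tau(\mathbb G_2,\mathbb C^7)$ be holomorphic at $\alpha$. Set $K'=h(\alpha)^{-1}K$ and $p_{\alpha,K}*h=p_{\alpha,K}\,h\,p_{\alpha,K'}^{-1}$. Then $p_{\alpha,K}*h$ is holomorphic at $\alpha$ as a loop in $\mathrm{SO}(7,\mathbb C)$, so that $L'=(p_{\alpha,K}*h)(\alpha)^{-1}L$ is defined, and: 1. the pair $(L',K')$ satisfies the $\mathbb G_2$ pair condition; 2. $p_{\alpha,L',K'}\in\mathcal L_-^\tau(\mathbb G_2,\mathbb C^7)$, and it has simple poles at $\alpha$ and $\bar\alpha$; 3. $p_{\alpha,L,K}\,h\,p_{\alpha,L',K'}^{-1}\in\mathcal L_-^\tau(\mathbb G_2,\mathbb C^7)$, and it is holomorphic at $\alpha$ and at $\bar\alpha$. -/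

import Mathlib

open scoped Matrix ComplexConjugate

namespace G2Loop

noncomputable section

/-- `ℂ⁷ = Im(𝕆) ⊗ ℂ` with its standard Hermitian inner product. -/
abbrev C7 : Type := EuclideanSpace ℂ (Fin 7)

/-- Complex `7 × 7` matrices, acting on `ℂ⁷`. -/
abbrev Mat7 : Type := Matrix (Fin 7) (Fin 7) ℂ

/-! ### Bilinear form, conjugation, octonions -/

/-- The complex bilinear extension `⟨x, y⟩` of the Euclidean inner product of `ℝ⁷`. -/
def bil (x y : C7) : ℂ := ∑ i, x i * y i

/-- Multiplication table of the imaginary octonion units: with `e₁, …, e₇` indexed by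
`0, …, 6`, the entry `±k` at `(i, j)` means `eᵢ₊₁ eⱼ₊₁ = ±eₖ`; the zeros on the diagonal say that
`eᵢ² = -1` has no imaginary part. -/
def octTable : Matrix (Fin 7) (Fin 7) ℤ :=
  !![ 0, -5, -6, -7,  2,  3,  4;
      5,  0, -7,  6, -1, -4,  3;
      6,  7,  0, -5,  4, -1, -2;
      7, -6,  5,  0, -3,  2, -1;
     -2,  1, -4,  3,  0,  7, -6;
     -3,  4,  1, -2, -7,  0,  5;
     -4, -3,  2,  1,  6, -5,  0]

/-- The coefficient of `e_{k+1}` in `e_{i+1} e_{j+1}`. -/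
def octCoeff (i j k : Fin 7) : ℂ :=
  if octTable i j = (k : ℤ) + 1 then 1
  else if octTable i j = -((k : ℤ) + 1) then -1
  else 0

/-- The product `x · y` on `ℂ⁷`: the imaginary part of the octonion product. -/
def octProd (x y : C7) : C7 :=
  WithLp.toLp 2 fun k => ∑ i, ∑ j, octCoeff i j k * x i * y j

/-- Multiplication of the complexified octonions `𝕆 ⊗ ℂ = ℂ·1 ⊕ ℂ⁷`. -/
def octMul (p q : ℂ × C7) : ℂ × C7 :=
  (p.1 * q.1 - bil p.2 q.2, p.1 • q.2 + q.1 • p.2 + octProd p.2 q.2)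

/-- The linear map of `ℂ⁷` given by a matrix. -/
def act (A : Mat7) : C7 →ₗ[ℂ] C7 := Matrix.toEuclideanLin A

/-- The complex group `𝔾₂`: the automorphism group of `𝕆 ⊗ ℂ`, acting on `ℂ⁷`
(automorphisms fix `1` and preserve the imaginary part). -/
def G2 : Set Mat7 :=
  {A | IsUnit A ∧ ∀ p q : ℂ × C7,
    octMul (p.1, act A p.2) (q.1, act A q.2) =
      ((octMul p q).1, act A (octMul p q).2)}

/-- The complex special orthogonal group `SO(7, ℂ)`. -/
def SO7 : Set Mat7 := {A | Aᵀ * A = 1 ∧ A.det = 1}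

/-! ### Subspaces of `ℂ⁷` -/

/-- Complex conjugation on `ℂ⁷`. -/
def conjVec (x : C7) : C7 := WithLp.toLp 2 fun i => conj (x i)

/-- The complex conjugate of a subspace. -/
def conjSub (W : Submodule ℂ C7) : Submodule ℂ C7 where
  carrier := {x | conjVec x ∈ W}
  add_mem' := by
    intro x y hx hy
    have : conjVec (x + y) = conjVec x + conjVec y := by
      ext i; simp [conjVec]
    simpa only [Set.mem_ofPred_eq, this] using W.add_mem hx hy
  zero_mem' := by
    have : conjVec 0 = 0 := by ext i; simp [conjVec]
    simp only [Set.mem_ofPred_eq, this, W.zero_mem]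
  smul_mem' := by
    intro c x hx
    have : conjVec (c • x) = conj c • conjVec x := by
      ext i; simp [conjVec]
    simpa only [Set.mem_ofPred_eq, this] using W.smul_mem (conj c) hx

/-- The orthogonal complement with respect to the bilinear form. -/
def bilPerp (W : Submodule ℂ C7) : Submodule ℂ C7 where
  carrier := {x | ∀ y ∈ W, bil x y = 0}
  add_mem' := by
    intro x x' hx hx' y hy
    have : bil (x + x') y = bil x y + bil x' y := by
      simp [bil, add_mul, Finset.sum_add_distrib]
    rw [this, hx y hy, hx' y hy, add_zero]
  zero_mem' := by intro y _; simp [bil]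
  smul_mem' := by
    intro c x hx y hy
    have : bil (c • x) y = c * bil x y := by
      simp [bil, Finset.mul_sum, mul_assoc]
    rw [this, hx y hy, mul_zero]

/-- A subspace on which the bilinear form vanishes. -/
def IsIsotropic (W : Submodule ℂ C7) : Prop := ∀ x ∈ W, ∀ y ∈ W, bil x y = 0

/-- An isotropic line. -/
def IsIsotropicLine (L : Submodule ℂ C7) : Prop :=
  Module.finrank ℂ L = 1 ∧ IsIsotropic L

/-- A complex coassociative plane: an isotropic `2`-plane `C` with `C · C = 0`. -/
def IsComplexCoassociative (C : Submodule ℂ C7) : Prop :=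
  Module.finrank ℂ C = 2 ∧ IsIsotropic C ∧ ∀ x ∈ C, ∀ y ∈ C, octProd x y = 0

/-- `(L ⊕ L̄)^⊥`. -/
def midSpace (L : Submodule ℂ C7) : Submodule ℂ C7 := bilPerp (L ⊔ conjSub L)

/-- The `𝔾₂` pair condition: isotropic lines `L`, `K` with `K ⊆ L̄^⊥` such that
`L ⊕ π_{(L ⊕ L̄)^⊥} K` is complex coassociative. -/
structure IsG2Pair (L K : Submodule ℂ C7) : Prop where
  left_line : IsIsotropicLine L
  right_line : IsIsotropicLine K
  perp : K ≤ bilPerp (conjSub L)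
  coassoc : IsComplexCoassociative
    (L ⊔ K.map ((midSpace L).starProjection : C7 →ₗ[ℂ] C7))

/-! ### Rational loops -/

/-- Rational maps from the Riemann sphere to complex `7 × 7` matrices. -/
abbrev RatMat : Type := Matrix (Fin 7) (Fin 7) (RatFunc ℂ)

/-- No entry of `g` has a pole at `z`. -/
def RegularAt (g : RatMat) (z : ℂ) : Prop := ∀ i j, (g i j).denom.eval z ≠ 0

/-- The value `g(z)`, meaningful where `g` has no pole. -/
def value (g : RatMat) (z : ℂ) : Mat7 :=
  fun i j => (g i j).eval (RingHom.id ℂ) z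

/-- `g` is holomorphic at `z` as a loop in `G`: it has no pole there and `g(z) ∈ G`. -/
def HolomorphicAt (G : Set Mat7) (g : RatMat) (z : ℂ) : Prop :=
  RegularAt g z ∧ value g z ∈ G

/-- `g` has a simple pole at `z`. -/
def HasSimplePoleAt (g : RatMat) (z : ℂ) : Prop :=
  ¬ RegularAt g z ∧ RegularAt ((RatFunc.X - RatFunc.C z : RatFunc ℂ) • g) z

/-- The rational loops in `G` that satisfy the reality condition for `τ(A) = Ā` and are
negative, i.e. holomorphic at `∞` with value `1`. -/
structure IsNegRealLoop (G : Set Mat7) (g : RatMat) : Prop where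
  loop : ∃ U : Set ℂ, IsOpen U ∧ Dense U ∧ ∀ z ∈ U, HolomorphicAt G g z
  real : ∀ z : ℂ, RegularAt g z → RegularAt g (conj z) →
    (value g (conj z)).map (starRingEnd ℂ) = value g z
  neg : Filter.Tendsto (value g) (Bornology.cobounded ℂ) (nhds 1)

/-- The matrix of the Hermitian orthogonal projection onto `W`. -/
def projMat (W : Submodule ℂ C7) : Mat7 :=
  Matrix.toEuclideanLin.symm (W.starProjection : C7 →ₗ[ℂ] C7)

/-- A constant matrix as a rational map. -/
def constMat (A : Mat7) : RatMat := A.map RatFunc.C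

/-- The rational function `(λ - α) / (λ - ᾱ)`. -/
def moeb (α : ℂ) : RatFunc ℂ :=
  (RatFunc.X - RatFunc.C α) / (RatFunc.X - RatFunc.C (conj α))

/-- The simple element `p_{α,L}` of an isotropic line `L`:
`(λ - ᾱ)/(λ - α) π_{L̄} + π_{(L ⊕ L̄)^⊥} + (λ - α)/(λ - ᾱ) π_L`. -/
def simpleElt (α : ℂ) (L : Submodule ℂ C7) : RatMat :=
  (moeb α)⁻¹ • constMat (projMat (conjSub L)) + constMat (projMat (midSpace L))
    + moeb α • constMat (projMat L)

/-- `p_{α,L,K} = p_{α,L} p_{α,K}`. -/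
def pairElt (α : ℂ) (L K : Submodule ℂ C7) : RatMat := simpleElt α L * simpleElt α K

/-- The line `h(α)⁻¹ L`. -/
def pullLine (α : ℂ) (h : RatMat) (L : Submodule ℂ C7) : Submodule ℂ C7 :=
  L.map (act (value h α)⁻¹)

/-- `p_{α,K} * h = p_{α,K} h p_{α,K'}⁻¹` with `K' = h(α)⁻¹ K`. -/
def dress (α : ℂ) (K : Submodule ℂ C7) (h : RatMat) : RatMat :=
  simpleElt α K * h * (simpleElt α (pullLine α h K))⁻¹

end

end G2Loop

open G2Loop

/-! Let l, k span L, K, let w be the component of k in (L ⊕ L̄)^⊥, so that k = w + a l̄, and put μ =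
(λ − α)/(λ − ᾱ).

Membership in G₂. For a null pair (l, w) the skew map l wᵀ − w lᵀ is a derivation of the octonion
product (`IsNullPair.derivation`) and squares to zero, so it exponentiates to unipotent
automorphisms. The pairs (l, w) and (w̄, l̄) together give a copy of SL₂ in the automorphism group,
acting on span(l, w̄) and dually on span(l̄, w) (`IsNullFrame.isOctAut`). Both p_{α,L} and p_{α,K}
preserve these planes; on the first their determinants are μ and μ⁻¹. Only the product lies in SL₂,
hence in G₂ (`isOctAut_simpleMat_mul`).

Poles. Conjugating h by the simple elements of K and K' = h(α)⁻¹K creates no pole at α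
(`regularAt_dressing`): the simple-pole coefficients vanish by the choice of K', and the double-pole
coefficient vanishes to second order because the lines are null. Two applications show that f =
p_{L,K} h p_{L',K'}⁻¹ is orthogonal and regular at α, before anything is known about (L', K').

Inheritance (`IsG2VecPair.of_regularAt`). In p_{L',K'} = f⁻¹ p_{L,K} h the right side has at most a
simple pole, which forces K' ⊂ L̄'^⊥, and the residues satisfy Res' = f(α)⁻¹ Res h(α). The row space
of Res is the plane spanned by k and the component of l in (K ⊕ K̄)^⊥. It is moved by h(α) ∈ G₂
alone, so f(α) need not be known to lie in G₂. The plane is coassociative because the pair condition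
is symmetric in L and K (`cross_midPart_symm`), and the same symmetry translates the result back to
(L', K'). Then f is a product of G₂ loops, and reality carries regularity from α to ᾱ.

Throughout, a loop in G₂ is treated as a matrix over the field ℂ(λ) satisfying the automorphism
identities, which specialise at every regular point. -/

namespace G2Loop

open Matrix Filter

/-! ### The cross product of imaginary octonions over a commutative ring -/

section Cross

variable {R : Type*} [CommRing R]

/-- The imaginary part of the product of imaginary octonions over a commutative ring. -/
def cross (x y : Fin 7 → R) : Fin 7 → R :=
  ![-(x 1 * y 4 - x 4 * y 1) - (x 2 * y 5 - x 5 * y 2) - (x 3 * y 6 - x 6 * y 3),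
    (x 0 * y 4 - x 4 * y 0) - (x 2 * y 6 - x 6 * y 2) + (x 3 * y 5 - x 5 * y 3),
    (x 0 * y 5 - x 5 * y 0) + (x 1 * y 6 - x 6 * y 1) - (x 3 * y 4 - x 4 * y 3),
    (x 0 * y 6 - x 6 * y 0) - (x 1 * y 5 - x 5 * y 1) + (x 2 * y 4 - x 4 * y 2),
    -(x 0 * y 1 - x 1 * y 0) - (x 2 * y 3 - x 3 * y 2) + (x 5 * y 6 - x 6 * y 5),
    -(x 0 * y 2 - x 2 * y 0) + (x 1 * y 3 - x 3 * y 1) - (x 4 * y 6 - x 6 * y 4),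
    -(x 0 * y 3 - x 3 * y 0) - (x 1 * y 2 - x 2 * y 1) + (x 4 * y 5 - x 5 * y 4)]

theorem cross_add_left (x x' y : Fin 7 → R) : cross (x + x') y = cross x y + cross x' y := by
  ext i; fin_cases i <;> simp [cross] <;> ring

theorem cross_smul_left (c : R) (x y : Fin 7 → R) : cross (c • x) y = c • cross x y := by
  ext i; fin_cases i <;> simp [cross] <;> ring

theorem cross_swap (x y : Fin 7 → R) : cross x y = -cross y x := by
  ext i; fin_cases i <;> simp [cross] <;> ring

theorem cross_self (x : Fin 7 → R) : cross x x = 0 := by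
  ext i; fin_cases i <;> simp [cross] <;> ring

theorem cross_zero_left (y : Fin 7 → R) : cross 0 y = 0 := by
  simpa using cross_smul_left (0 : R) 0 y

theorem cross_neg_left (x y : Fin 7 → R) : cross (-x) y = -cross x y := by
  simpa using cross_smul_left (-1 : R) x y

theorem cross_sub_left (x x' y : Fin 7 → R) : cross (x - x') y = cross x y - cross x' y := by
  rw [sub_eq_add_neg, cross_add_left, cross_neg_left, sub_eq_add_neg]

theorem cross_add_right (x y y' : Fin 7 → R) : cross x (y + y') = cross x y + cross x y' := by
  rw [cross_swap, cross_add_left, cross_swap x y, cross_swap x y']; abel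

theorem cross_smul_right (c : R) (x y : Fin 7 → R) : cross x (c • y) = c • cross x y := by
  rw [cross_swap, cross_smul_left, cross_swap x y, smul_neg]

theorem cross_zero_right (x : Fin 7 → R) : cross x 0 = 0 := by
  rw [cross_swap, cross_zero_left, neg_zero]

theorem cross_neg_right (x y : Fin 7 → R) : cross x (-y) = -cross x y := by
  simpa using cross_smul_right (-1 : R) x y

theorem cross_sub_right (x y y' : Fin 7 → R) : cross x (y - y') = cross x y - cross x y' := by
  rw [sub_eq_add_neg, cross_add_right, cross_neg_right, sub_eq_add_neg]

theorem cross_dotProduct_cyclic (x y z : Fin 7 → R) : cross x y ⬝ᵥ z = cross y z ⬝ᵥ x := by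
  simp [cross, dotProduct, Fin.sum_univ_succ]; ring

/-- Linearised alternativity: the polarisation of x × (x × y) = (x·y) x − (x·x) y. Besides
bilinearity and antisymmetry, the derivation property uses only this and `cross_dotProduct_cyclic`.
-/
theorem cross_cross (x z y : Fin 7 → R) :
    cross x (cross z y) + cross z (cross x y) =
      (x ⬝ᵥ y) • z + (z ⬝ᵥ y) • x - (2 * (x ⬝ᵥ z)) • y := by
  ext i
  fin_cases i <;> simp [cross, dotProduct, Fin.sum_univ_succ] <;> ring

/-- Two isotropic vectors, orthogonal to each other, whose octonion product vanishes. -/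
structure IsNullPair (l w : Fin 7 → R) : Prop where
  left : l ⬝ᵥ l = 0
  mid : l ⬝ᵥ w = 0
  right : w ⬝ᵥ w = 0
  cross : cross l w = 0

theorem IsNullPair.smul_right {l w : Fin 7 → R} (h : IsNullPair l w) (c : R) :
    IsNullPair l (c • w) :=
  ⟨h.left, by simp [h.mid], by simp [h.right], by simp [cross_smul_right, h.cross]⟩

theorem IsNullPair.symm {l w : Fin 7 → R} (h : IsNullPair l w) : IsNullPair w l :=
  ⟨h.right, by rw [dotProduct_comm, h.mid], h.left, by rw [cross_swap, h.cross, neg_zero]⟩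

theorem IsNullPair.cross_cross {l w : Fin 7 → R} (h : IsNullPair l w) (y : Fin 7 → R) :
    G2Loop.cross l (G2Loop.cross w y) = (2 * (l ⬝ᵥ y)) • w - (w ⬝ᵥ y) • l := by
  have := G2Loop.cross_cross l y w
  rw [h.cross, h.mid, cross_zero_right, cross_swap y w, cross_neg_right, dotProduct_comm y w] at this
  linear_combination (norm := module) -this

/-- The skew map of a null pair is a derivation of the cross product. -/
theorem IsNullPair.derivation {l w : Fin 7 → R} (h2 : IsUnit (2 : R)) (h : IsNullPair l w)
    (x y : Fin 7 → R) :
    (w ⬝ᵥ G2Loop.cross x y) • l - (l ⬝ᵥ G2Loop.cross x y) • w =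
      G2Loop.cross ((w ⬝ᵥ x) • l - (l ⬝ᵥ x) • w) y +
        G2Loop.cross x ((w ⬝ᵥ y) • l - (l ⬝ᵥ y) • w) := by
  -- Expand w × (l × (x × y)) in two ways: directly by the null pair identity, and by moving first
  -- l, then w past x with `cross_cross`. The comparison gives twice the claim, so 2 has to be
  -- cancelled.
  have e1 := h.symm.cross_cross (G2Loop.cross x y)
  have e2 : G2Loop.cross l (G2Loop.cross x y) = -G2Loop.cross x (G2Loop.cross l y) +
      (x ⬝ᵥ y) • l + (l ⬝ᵥ y) • x - (2 * (x ⬝ᵥ l)) • y := by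
    have := G2Loop.cross_cross x l y
    linear_combination (norm := module) this
  have e3 := G2Loop.cross_cross w x (G2Loop.cross l y)
  have e4 : w ⬝ᵥ G2Loop.cross l y = 0 := by
    rw [dotProduct_comm, ← cross_dotProduct_cyclic, h.symm.cross, zero_dotProduct]
  have e5 : x ⬝ᵥ G2Loop.cross l y = -(l ⬝ᵥ G2Loop.cross x y) := by
    rw [dotProduct_comm, cross_dotProduct_cyclic, cross_swap y x, neg_dotProduct, dotProduct_comm]
  rw [h.symm.cross_cross] at e3
  rw [e2] at e1
  simp only [cross_add_right, cross_sub_right, cross_smul_right, cross_neg_right, h.symm.cross,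
    cross_sub_left, cross_smul_left, e4, e5, cross_swap x w, dotProduct_comm x l] at e1 e3 ⊢
  rw [← h2.smul_left_cancel]
  linear_combination (norm := module) -e1 - e3

/-- Apply the derivation attached to (x', y') to the equation x × y = 0; orthogonality kills all but
two terms. The case of interest is x' = x̄, y' = ȳ. -/
theorem IsNullPair.swap_identity {x y x' y' : Fin 7 → R} (h2 : IsUnit (2 : R))
    (h : IsNullPair x y) (h' : IsNullPair x' y') (hxy : x ⬝ᵥ y' = 0) (hyx : y ⬝ᵥ x' = 0) :
    (y ⬝ᵥ y') • G2Loop.cross x x' = (x ⬝ᵥ x') • G2Loop.cross y' y := by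
  have := h'.derivation h2 x y
  rw [h.cross] at this
  simp only [dotProduct_zero, zero_smul, sub_zero, cross_sub_left,
    cross_smul_left, cross_smul_right, cross_zero_left, dotProduct_comm y' x, dotProduct_comm x' y,
    dotProduct_comm x' x, dotProduct_comm y' y, hxy, hyx] at this
  linear_combination (norm := module) -this

/-- A matrix that preserves the bilinear form and the octonion product. -/
structure IsOctAut (A : Matrix (Fin 7) (Fin 7) R) : Prop where
  orth : Aᵀ * A = 1
  map_cross : ∀ x y, A *ᵥ G2Loop.cross x y = G2Loop.cross (A *ᵥ x) (A *ᵥ y)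

theorem IsOctAut.mul {A B : Matrix (Fin 7) (Fin 7) R} (hA : IsOctAut A) (hB : IsOctAut B) :
    IsOctAut (A * B) where
  orth := by
    rw [transpose_mul, Matrix.mul_assoc, ← Matrix.mul_assoc Aᵀ, hA.orth, Matrix.one_mul, hB.orth]
  map_cross x y := by simp only [← mulVec_mulVec, hB.map_cross, hA.map_cross]

theorem IsOctAut.transpose {A : Matrix (Fin 7) (Fin 7) R} (hA : IsOctAut A) : IsOctAut Aᵀ where
  orth := by rw [transpose_transpose]; exact mul_eq_one_comm.mp hA.orth
  map_cross x y := by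
    have h1 : ∀ z, A *ᵥ (Aᵀ *ᵥ z) = z := fun z => by
      rw [mulVec_mulVec, mul_eq_one_comm.mp hA.orth, one_mulVec]
    have h2 : ∀ z, Aᵀ *ᵥ (A *ᵥ z) = z := fun z => by rw [mulVec_mulVec, hA.orth, one_mulVec]
    rw [← h2 (G2Loop.cross (Aᵀ *ᵥ x) (Aᵀ *ᵥ y)), hA.map_cross, h1, h1]

/-- The unipotent transformation `1 + s (l wᵀ - w lᵀ)` of a null pair. -/
theorem IsNullPair.isOctAut {l w : Fin 7 → R} (h2 : IsUnit (2 : R)) (h : IsNullPair l w) (s : R) :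
    IsOctAut (1 + s • (vecMulVec l w - vecMulVec w l)) where
  orth := by
    have hm := h.mid
    have hm' := h.symm.mid
    have hl := h.left
    have hr := h.right
    simp only [transpose_add, transpose_smul, transpose_sub, transpose_vecMulVec, transpose_one,
      Matrix.mul_add, Matrix.add_mul, Matrix.mul_sub, Matrix.sub_mul, Matrix.smul_mul,
      Matrix.mul_smul, vecMulVec_mul_vecMulVec, hm, hm', hl, hr, Matrix.one_mul, Matrix.mul_one,
      zero_smul, vecMulVec_zero]
    module
  map_cross x y := by
    have hd := h.derivation h2 x y
    have key : ∀ z, (1 + s • (vecMulVec l w - vecMulVec w l)) *ᵥ z =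
        z + s • ((w ⬝ᵥ z) • l - (l ⬝ᵥ z) • w) := fun z => by
      simp [add_mulVec, smul_mulVec, sub_mulVec, vecMulVec_mulVec]
    -- The terms linear in s agree by the derivation property. The s² term vanishes because the skew
    -- map takes values in the span of l and w, on which the product is zero.
    rw [key, key, key, hd]
    simp only [cross_add_left, cross_sub_left, cross_smul_left, cross_add_right, cross_sub_right,
      cross_smul_right, h.cross, h.symm.cross, cross_self]
    module

end Cross

/-! ### The action of `SL₂` on a hyperbolic frame -/

section Frame

variable {F : Type*} [Field F]

/-- The matrix that acts by `M` on the span of the columns of `E` and by `N` on the span of the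
columns of `E'`. -/
def frameMat (E E' : Matrix (Fin 7) (Fin 2) F) (M N : Matrix (Fin 2) (Fin 2) F) :
    Matrix (Fin 7) (Fin 7) F :=
  1 + E * (M - 1) * E'ᵀ + E' * (N - 1) * Eᵀ

theorem frameMat_mul {E E' : Matrix (Fin 7) (Fin 2) F} (h1 : Eᵀ * E' = 1) (h2 : Eᵀ * E = 0)
    (h3 : E'ᵀ * E' = 0) (M N M' N' : Matrix (Fin 2) (Fin 2) F) :
    frameMat E E' M N * frameMat E E' M' N' = frameMat E E' (M * M') (N * N') := by
  have h1' : E'ᵀ * E = 1 := by simpa using congrArg transpose h1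
  have k1 : ∀ (A B : Matrix (Fin 2) (Fin 2) F), E * A * E'ᵀ * (E * B * E'ᵀ) = E * (A * B) * E'ᵀ :=
    fun A B => by
      rw [show E * A * E'ᵀ * (E * B * E'ᵀ) = E * A * (E'ᵀ * E) * B * E'ᵀ by
        simp only [Matrix.mul_assoc], h1', Matrix.mul_one, Matrix.mul_assoc E]
  have k2 : ∀ (A B : Matrix (Fin 2) (Fin 2) F), E' * A * Eᵀ * (E' * B * Eᵀ) = E' * (A * B) * Eᵀ :=
    fun A B => by
      rw [show E' * A * Eᵀ * (E' * B * Eᵀ) = E' * A * (Eᵀ * E') * B * Eᵀ by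
        simp only [Matrix.mul_assoc], h1, Matrix.mul_one, Matrix.mul_assoc E']
  have k3 : ∀ (A B : Matrix (Fin 2) (Fin 2) F), E * A * E'ᵀ * (E' * B * Eᵀ) = 0 :=
    fun A B => by
      rw [show E * A * E'ᵀ * (E' * B * Eᵀ) = E * A * (E'ᵀ * E') * B * Eᵀ by
        simp only [Matrix.mul_assoc], h3]
      simp
  have k4 : ∀ (A B : Matrix (Fin 2) (Fin 2) F), E' * A * Eᵀ * (E * B * E'ᵀ) = 0 :=
    fun A B => by
      rw [show E' * A * Eᵀ * (E * B * E'ᵀ) = E' * A * (Eᵀ * E) * B * E'ᵀ by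
        simp only [Matrix.mul_assoc], h2]
      simp
  have e1 : M * M' - 1 = (M - 1) + (M' - 1) + (M - 1) * (M' - 1) := by noncomm_ring
  have e2 : N * N' - 1 = (N - 1) + (N' - 1) + (N - 1) * (N' - 1) := by noncomm_ring
  simp only [frameMat, e1, e2, Matrix.mul_add, Matrix.add_mul, k1, k2, k3, k4, Matrix.mul_one,
    Matrix.one_mul]
  abel

/-- The frame with columns `a`, `b`. -/
def pairCols (a b : Fin 7 → F) : Matrix (Fin 7) (Fin 2) F := (of ![a, b])ᵀ

theorem pairCols_mul (a b c d : Fin 7 → F) (p q r s : F) :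
    pairCols a b * !![p, q; r, s] * (pairCols c d)ᵀ =
      p • vecMulVec a c + q • vecMulVec a d + r • vecMulVec b c + s • vecMulVec b d := by
  ext i j
  simp [pairCols, Matrix.mul_apply, vecMulVec_apply]
  ring

theorem frameMat_pairCols (a b c d : Fin 7 → F) (p q r s p' q' r' s' : F) :
    frameMat (pairCols a b) (pairCols c d) !![p, q; r, s] !![p', q'; r', s'] =
      1 + ((p - 1) • vecMulVec a c + q • vecMulVec a d + r • vecMulVec b c
        + (s - 1) • vecMulVec b d) +
      ((p' - 1) • vecMulVec c a + q' • vecMulVec c b + r' • vecMulVec d a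
        + (s' - 1) • vecMulVec d b) := by
  rw [frameMat, Matrix.one_fin_two, ← pairCols_mul, ← pairCols_mul]
  simp

/-- Vectors `e₁, e₂` and `f₁, f₂` spanning isotropic planes dual to each other, such that
`(e₁, f₂)` and `(e₂, f₁)` are null pairs. -/
structure IsNullFrame (e₁ e₂ f₁ f₂ : Fin 7 → F) : Prop where
  ef : IsNullPair e₁ f₂
  ef' : IsNullPair e₂ f₁
  dual₁ : e₁ ⬝ᵥ f₁ = 1
  dual₂ : e₂ ⬝ᵥ f₂ = 1
  ee : e₁ ⬝ᵥ e₂ = 0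
  ff : f₁ ⬝ᵥ f₂ = 0

variable {e₁ e₂ f₁ f₂ : Fin 7 → F}

theorem pairCols_transpose_mul (a b c d : Fin 7 → F) :
    (pairCols a b)ᵀ * pairCols c d = !![a ⬝ᵥ c, a ⬝ᵥ d; b ⬝ᵥ c, b ⬝ᵥ d] := by
  ext i j
  fin_cases i <;> fin_cases j <;> simp [pairCols, Matrix.mul_apply, dotProduct]

theorem IsNullFrame.mul (h : IsNullFrame e₁ e₂ f₁ f₂) (M N M' N' : Matrix (Fin 2) (Fin 2) F) :
    frameMat (pairCols e₁ e₂) (pairCols f₁ f₂) M N *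
      frameMat (pairCols e₁ e₂) (pairCols f₁ f₂) M' N' =
      frameMat (pairCols e₁ e₂) (pairCols f₁ f₂) (M * M') (N * N') := by
  apply frameMat_mul <;> rw [pairCols_transpose_mul]
  · rw [h.dual₁, h.dual₂, h.ef.mid, h.ef'.mid, one_fin_two]
  · rw [h.ef.left, h.ef'.left, dotProduct_comm e₂, h.ee]; ext i j; fin_cases i <;> fin_cases j <;> rfl
  · rw [h.ef.right, h.ef'.right, dotProduct_comm f₂, h.ff]; ext i j; fin_cases i <;> fin_cases j <;> rfl

/-- The unipotents of (e₁, f₂) and (e₂, f₁) act as upper and lower unitriangular matrices, and for r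
≠ 0 these generate: the matrix is upper · lower · upper with parameters (p − 1)/r, r, (s − 1)/r. The
second block is the inverse transpose, since the two planes are dual under the bilinear form. -/
theorem IsNullFrame.isOctAut_of_ne_zero (h2 : (2 : F) ≠ 0) (h : IsNullFrame e₁ e₂ f₁ f₂)
    {p q r s : F} (hdet : p * s - q * r = 1) (hr : r ≠ 0) :
    IsOctAut (frameMat (pairCols e₁ e₂) (pairCols f₁ f₂) !![p, q; r, s] !![s, -r; -q, p]) := by
  have hU : ∀ x : F, IsOctAut
      (frameMat (pairCols e₁ e₂) (pairCols f₁ f₂) !![1, x; 0, 1] !![1, 0; -x, 1]) := fun x => by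
    convert h.ef.isOctAut (IsUnit.mk0 _ h2) x using 1
    rw [frameMat_pairCols]; module
  have hL : ∀ x : F, IsOctAut
      (frameMat (pairCols e₁ e₂) (pairCols f₁ f₂) !![1, 0; x, 1] !![1, -x; 0, 1]) := fun x => by
    convert h.ef'.isOctAut (IsUnit.mk0 _ h2) x using 1
    rw [frameMat_pairCols]; module
  have hq : q = (p * s - 1) / r := by field_simp; linear_combination -hdet
  convert ((hU ((p - 1) / r)).mul (hL r)).mul (hU ((s - 1) / r)) using 1
  rw [h.mul, h.mul, hq]
  congr 1 <;> ext i j <;> fin_cases i <;> fin_cases j <;>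
    simp [Matrix.mul_apply] <;> field_simp <;> ring

theorem IsNullFrame.isOctAut (h2 : (2 : F) ≠ 0) (h : IsNullFrame e₁ e₂ f₁ f₂)
    {p q r s : F} (hdet : p * s - q * r = 1) :
    IsOctAut (frameMat (pairCols e₁ e₂) (pairCols f₁ f₂) !![p, q; r, s] !![s, -r; -q, p]) := by
  by_cases hr : r = 0
  · subst hr
    have hs : s ≠ 0 := by rintro rfl; simp at hdet
    -- Reduction to a nonzero lower left entry: [p, q; 0, s] = [p + q, q; s, s] · [1, 0; −1, 1].
    have h1 := h.isOctAut_of_ne_zero h2 (p := p + q) (q := q) (r := s) (s := s)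
      (by linear_combination hdet) hs
    have h3 := h.isOctAut_of_ne_zero h2 (p := 1) (q := 0) (r := -1) (s := 1) (by ring) (by simp)
    convert h1.mul h3 using 1
    rw [h.mul]
    congr 1 <;> ext i j <;> fin_cases i <;> fin_cases j <;> simp [Matrix.mul_apply]
  · exact h.isOctAut_of_ne_zero h2 hdet hr

/-- The simple element with eigenvalues `μ⁻¹`, `1`, `μ`, where `μ` belongs to `l` and `μ⁻¹` to the
dual vector `l'`. -/
def simpleMat (μ : F) (l l' : Fin 7 → F) : Matrix (Fin 7) (Fin 7) F :=
  1 + ((μ⁻¹ - 1) / (l ⬝ᵥ l')) • vecMulVec l' l + ((μ - 1) / (l ⬝ᵥ l')) • vecMulVec l l'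

theorem simpleMat_transpose (μ : F) (l l' : Fin 7 → F) :
    (simpleMat μ l l')ᵀ = simpleMat μ l' l := by
  simp [simpleMat, transpose_vecMulVec, dotProduct_comm l' l]

theorem simpleMat_transpose_mul {μ : F} (hμ : μ ≠ 0) {l l' : Fin 7 → F} (h : l ⬝ᵥ l = 0)
    (h' : l' ⬝ᵥ l' = 0) (hn : l ⬝ᵥ l' ≠ 0) : (simpleMat μ l l')ᵀ * simpleMat μ l l' = 1 := by
  rw [simpleMat_transpose]
  simp only [simpleMat, Matrix.mul_add, Matrix.add_mul, Matrix.smul_mul,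
      Matrix.mul_smul, vecMulVec_mul_vecMulVec, h, h', Matrix.one_mul, Matrix.mul_one,
      zero_smul, vecMulVec_zero, vecMulVec_smul, dotProduct_comm l' l]
  match_scalars <;> field_simp <;> ring

/-- Since l·l = 0, the matrix is a product of two rank-one perturbations of the identity, with
determinants μ⁻¹ and μ. -/
theorem det_simpleMat {μ : F} (hμ : μ ≠ 0) {l l' : Fin 7 → F} (h : l ⬝ᵥ l = 0)
    (hn : l ⬝ᵥ l' ≠ 0) : (simpleMat μ l l').det = 1 := by
  have : simpleMat μ l l' = (1 + vecMulVec (((μ⁻¹ - 1) / (l ⬝ᵥ l')) • l') l) *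
      (1 + vecMulVec (((μ - 1) / (l ⬝ᵥ l')) • l) l') := by
    simp only [simpleMat, Matrix.mul_add, Matrix.add_mul, smul_vecMulVec,
      Matrix.smul_mul, Matrix.mul_smul, vecMulVec_mul_vecMulVec, h,
      Matrix.one_mul, Matrix.mul_one, zero_smul, vecMulVec_zero, smul_zero]
    module
  rw [this, det_mul, vecMulVec_eq Unit, vecMulVec_eq Unit,
    det_one_add_replicateCol_mul_replicateRow, det_one_add_replicateCol_mul_replicateRow]
  simp only [dotProduct_smul, dotProduct_comm l' l, smul_eq_mul]
  field_simp
  ring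

/-- Both factors preserve span(l, w') and its dual span(l', w). On the first plane their
determinants are μ and μ⁻¹, so the product falls into SL₂ although for μ ≠ 1 neither factor does. In
the application l' = l̄, w is the middle part of k and a l' its component along l̄. -/
theorem isOctAut_simpleMat_mul (h2 : (2 : F) ≠ 0) {μ a a' : F} (hμ : μ ≠ 0)
    {l l' w w' : Fin 7 → F}
    (hlw : IsNullPair l w) (hlw' : IsNullPair l' w') (hl : l ⬝ᵥ l' ≠ 0) (hw : w ⬝ᵥ w' ≠ 0)
    (h1 : l ⬝ᵥ w' = 0) (h3 : l' ⬝ᵥ w = 0)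
    (hk : (w + a • l') ⬝ᵥ (w' + a' • l) ≠ 0) :
    IsOctAut (simpleMat μ l l' * simpleMat μ (w + a • l') (w' + a' • l)) := by
  have fr : IsNullFrame l ((w ⬝ᵥ w')⁻¹ • w') ((l ⬝ᵥ l')⁻¹ • l') w :=
    { ef := hlw
      ef' := (hlw'.smul_right _).symm.smul_right _ |>.symm.symm
      dual₁ := by simp [hl]
      dual₂ := by simp [dotProduct_comm w' w, hw]
      ee := by simp [h1]
      ff := by simp [h3] }
  have hn : (w + a • l') ⬝ᵥ (w' + a' • l) = w ⬝ᵥ w' + a * a' * (l ⬝ᵥ l') := by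
    have e1 := hlw.symm.mid
    have e2 := hlw'.mid
    simp [e1, e2, dotProduct_comm l' l]; ring
  rw [hn] at hk
  set c := (μ⁻¹ - 1) / (w ⬝ᵥ w' + a * a' * (l ⬝ᵥ l')) with hc
  set d := (μ - 1) / (w ⬝ᵥ w' + a * a' * (l ⬝ᵥ l')) with hd
  have eL : simpleMat μ l l' = frameMat (pairCols l ((w ⬝ᵥ w')⁻¹ • w'))
      (pairCols ((l ⬝ᵥ l')⁻¹ • l') w) !![μ, 0; 0, 1] !![μ⁻¹, 0; 0, 1] := by
    rw [frameMat_pairCols, simpleMat]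
    simp only [smul_vecMulVec, vecMulVec_smul]
    match_scalars <;> field_simp <;> ring
  have eK : simpleMat μ (w + a • l') (w' + a' • l) = frameMat (pairCols l ((w ⬝ᵥ w')⁻¹ • w'))
      (pairCols ((l ⬝ᵥ l')⁻¹ • l') w)
      !![1 + c * a' * a * (l ⬝ᵥ l'), c * a'; c * (w ⬝ᵥ w') * a * (l ⬝ᵥ l'), 1 + c * (w ⬝ᵥ w')]
      !![1 + d * a' * a * (l ⬝ᵥ l'), d * (w ⬝ᵥ w') * a * (l ⬝ᵥ l'); d * a', 1 + d * (w ⬝ᵥ w')] := by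
    rw [frameMat_pairCols, simpleMat, hn, ← hc, ← hd]
    simp only [smul_vecMulVec, vecMulVec_smul, add_vecMulVec, vecMulVec_add]
    match_scalars <;> field_simp <;> ring
  rw [eL, eK, fr.mul]
  convert fr.isOctAut h2 (p := μ * (1 + c * a' * a * (l ⬝ᵥ l'))) (q := μ * (c * a'))
    (r := c * (w ⬝ᵥ w') * a * (l ⬝ᵥ l')) (s := 1 + c * (w ⬝ᵥ w')) ?_ using 1
  · congr 1
    all_goals
      ext i j
      fin_cases i <;> fin_cases j <;> simp [Matrix.mul_apply, hc, hd] <;> field_simp <;> ring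
  · rw [hc]; field_simp; ring

end Frame

/-! ### Automorphisms of the octonions and ring homomorphisms -/

section Transfer

variable {R S : Type*} [CommRing R] [CommRing S]

/-- The octonion cross product as a bilinear map. -/
def crossLin (R : Type*) [CommRing R] : (Fin 7 → R) →ₗ[R] (Fin 7 → R) →ₗ[R] (Fin 7 → R) :=
  LinearMap.mk₂ R cross cross_add_left cross_smul_left cross_add_right cross_smul_right

theorem map_cross_comp (φ : R →+* S) (x y : Fin 7 → R) :
    φ ∘ cross x y = cross (φ ∘ x) (φ ∘ y) := by
  ext i; fin_cases i <;> simp [cross]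

/-- Basis vectors are constant, so this form consists of finitely many identities between entries
that can be evaluated at a point; arbitrary vectors of rational functions may have poles there. -/
theorem isOctAut_iff_single {A : Matrix (Fin 7) (Fin 7) R} :
    IsOctAut A ↔ Aᵀ * A = 1 ∧ ∀ i j, A *ᵥ cross (Pi.single i 1) (Pi.single j 1) =
      cross (A *ᵥ Pi.single i 1) (A *ᵥ Pi.single j 1) := by
  refine ⟨fun h => ⟨h.orth, fun i j => h.map_cross _ _⟩, fun h => ⟨h.1, fun x y => ?_⟩⟩
  have : (crossLin R).compr₂ A.mulVecLin = (crossLin R).compl₁₂ A.mulVecLin A.mulVecLin := by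
    refine LinearMap.pi_ext' fun i => LinearMap.ext_ring <| LinearMap.pi_ext' fun j =>
      LinearMap.ext_ring ?_
    exact h.2 i j
  exact LinearMap.congr_fun₂ this x y

theorem map_mulVec_comp (φ : R →+* S) (A : Matrix (Fin 7) (Fin 7) R) (x : Fin 7 → R) :
    φ ∘ (A *ᵥ x) = A.map φ *ᵥ (φ ∘ x) := by
  ext i; exact RingHom.map_mulVec φ A x i

theorem map_comp_single (φ : R →+* S) (i : Fin 7) :
    φ ∘ (Pi.single i 1 : Fin 7 → R) = Pi.single i 1 := by
  ext j; by_cases h : j = i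
  · subst h; simp
  · simp [h]

theorem comp_mulVec_cross_single (φ : R →+* S) (A : Matrix (Fin 7) (Fin 7) R) (i j : Fin 7) :
    φ ∘ (A *ᵥ cross (Pi.single i 1) (Pi.single j 1)) =
      A.map φ *ᵥ cross (Pi.single i 1) (Pi.single j 1) := by
  rw [map_mulVec_comp, map_cross_comp, map_comp_single, map_comp_single]

theorem comp_cross_mulVec_single (φ : R →+* S) (A : Matrix (Fin 7) (Fin 7) R) (i j : Fin 7) :
    φ ∘ cross (A *ᵥ Pi.single i 1) (A *ᵥ Pi.single j 1) =
      cross (A.map φ *ᵥ Pi.single i 1) (A.map φ *ᵥ Pi.single j 1) := by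
  rw [map_cross_comp, map_mulVec_comp, map_mulVec_comp, map_comp_single, map_comp_single]

theorem IsOctAut.map {A : Matrix (Fin 7) (Fin 7) R} (h : IsOctAut A) (φ : R →+* S) :
    IsOctAut (A.map φ) := by
  rw [isOctAut_iff_single]
  refine ⟨?_, fun i j => ?_⟩
  · rw [← transpose_map, ← Matrix.map_mul, h.orth, Matrix.map_one _ (map_zero φ) (map_one φ)]
  · have := congrArg (φ ∘ ·) (h.map_cross (Pi.single i 1) (Pi.single j 1))
    simpa only [map_mulVec_comp, map_cross_comp, map_comp_single] using this

theorem IsOctAut.of_map {A : Matrix (Fin 7) (Fin 7) R} {φ : R →+* S} (hφ : Function.Injective φ)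
    (h : IsOctAut (A.map φ)) : IsOctAut A where
  orth := Matrix.map_injective hφ (by
    simp only [Matrix.map_mul, transpose_map, h.orth, Matrix.map_one _ (map_zero φ) (map_one φ)])
  map_cross x y := hφ.comp_left (by
    simp only [map_mulVec_comp, map_cross_comp, h.map_cross])

end Transfer

/-! ### The group `G2` in terms of the cross product -/

theorem octProd_eq (x y : C7) : octProd x y = WithLp.toLp 2 (cross x.ofLp y.ofLp) := by
  ext k
  fin_cases k <;>
    simp [octProd, cross, octCoeff, octTable, Fin.sum_univ_succ] <;> ring

theorem bil_eq (x y : C7) : bil x y = x.ofLp ⬝ᵥ y.ofLp := rfl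

theorem act_eq (A : Mat7) (x : C7) : act A x = WithLp.toLp 2 (A *ᵥ x.ofLp) := rfl

theorem transpose_mul_eq_one_iff {R : Type*} [CommRing R] {A : Matrix (Fin 7) (Fin 7) R} :
    Aᵀ * A = 1 ↔ ∀ x y, (A *ᵥ x) ⬝ᵥ (A *ᵥ y) = x ⬝ᵥ y := by
  have key : ∀ x y, (A *ᵥ x) ⬝ᵥ (A *ᵥ y) = x ⬝ᵥ ((Aᵀ * A) *ᵥ y) := fun x y => by
    rw [← mulVec_mulVec, dotProduct_mulVec x, vecMul_transpose]
  refine ⟨fun h x y => by rw [key, h, one_mulVec], fun h => ?_⟩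
  refine Matrix.ext_of_mulVec_single fun j => ?_
  refine dotProduct_eq _ _ fun x => ?_
  rw [dotProduct_comm, ← key, h, one_mulVec, dotProduct_comm]

/-- On imaginary octonions the real part of the product is minus the bilinear form and the imaginary
part is the cross product. Invertibility comes from orthogonality. -/
theorem mem_G2_iff {A : Mat7} : A ∈ G2 ↔ IsOctAut A := by
  constructor
  · rintro ⟨-, h⟩
    refine ⟨transpose_mul_eq_one_iff.mpr fun x y => ?_, fun x y => ?_⟩
    · have := congrArg Prod.fst (h (0, WithLp.toLp 2 x) (0, WithLp.toLp 2 y))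
      simpa [octMul, bil_eq, act_eq] using this
    · have := congrArg (fun p => p.2.ofLp) (h (0, WithLp.toLp 2 x) (0, WithLp.toLp 2 y))
      simpa [octMul, octProd_eq, act_eq] using this.symm
  · intro h
    refine ⟨IsUnit.of_mul_eq_one_right _ h.orth, fun p q => ?_⟩
    have h1 := transpose_mul_eq_one_iff.mp h.orth
    refine Prod.ext ?_ ?_
    · simp [octMul, bil_eq, act_eq, h1]
    · simp only [octMul, map_add, map_smul]
      simp [octProd_eq, act_eq, h.map_cross]

/-! ### Rational functions regular at a point -/

/-- The ring of rational functions without pole at `z`. -/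
def localRing (z : ℂ) : Subring (RatFunc ℂ) where
  carrier := {f | f.denom.eval z ≠ 0}
  mul_mem' {f g} hf hg h0 := mul_ne_zero hf hg (by
    rw [← Polynomial.eval_mul]
    exact Polynomial.eval_eq_zero_of_dvd_of_eval_eq_zero (RatFunc.denom_mul_dvd f g) h0)
  add_mem' {f g} hf hg h0 := mul_ne_zero hf hg (by
    rw [← Polynomial.eval_mul]
    exact Polynomial.eval_eq_zero_of_dvd_of_eval_eq_zero (RatFunc.denom_add_dvd f g) h0)
  one_mem' := by simp
  zero_mem' := by simp
  neg_mem' {f} hf h0 := hf (by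
    have h2 : (-f).denom ∣ f.denom := by
      have := RatFunc.denom_mul_dvd (RatFunc.C (-1 : ℂ)) f
      rw [RatFunc.denom_C, one_mul] at this
      simpa using this
    exact Polynomial.eval_eq_zero_of_dvd_of_eval_eq_zero h2 h0)

theorem mem_localRing {z : ℂ} {f : RatFunc ℂ} : f ∈ localRing z ↔ f.denom.eval z ≠ 0 := Iff.rfl

/-- Evaluation at `z`. -/
noncomputable def evalAt (z : ℂ) : localRing z →+* ℂ where
  toFun f := f.1.eval (RingHom.id ℂ) z
  map_one' := RatFunc.eval_one _ _
  map_zero' := RatFunc.eval_zero _ _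
  map_mul' f g := RatFunc.eval_mul _ _ f.2 g.2
  map_add' f g := RatFunc.eval_add _ _ f.2 g.2

theorem evalAt_apply {z : ℂ} (f : localRing z) : evalAt z f = f.1.eval (RingHom.id ℂ) z := rfl

theorem div_mem_localRing {z : ℂ} (p : Polynomial ℂ) {q : Polynomial ℂ} (hq : q.eval z ≠ 0) :
    algebraMap _ (RatFunc ℂ) p / algebraMap _ (RatFunc ℂ) q ∈ localRing z := fun h0 =>
  hq (Polynomial.eval_eq_zero_of_dvd_of_eval_eq_zero (RatFunc.denom_div_dvd p q) h0)

theorem algebraMap_mem_localRing (z : ℂ) (p : Polynomial ℂ) :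
    algebraMap _ (RatFunc ℂ) p ∈ localRing z := by
  simpa using div_mem_localRing p (q := 1) (z := z) (by simp)

theorem C_mem_localRing (z c : ℂ) : RatFunc.C c ∈ localRing z := by
  rw [mem_localRing]; simp

theorem X_sub_C_mem_localRing (z c : ℂ) : RatFunc.X - RatFunc.C c ∈ localRing z :=
  sub_mem (by rw [mem_localRing]; simp) (C_mem_localRing z c)

theorem eval_X_sub_C (z c : ℂ) :
    (RatFunc.X - RatFunc.C c : RatFunc ℂ).eval (RingHom.id ℂ) z = z - c := by
  have : (RatFunc.X - RatFunc.C c : RatFunc ℂ) =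
      algebraMap (Polynomial ℂ) _ (Polynomial.X - Polynomial.C c) := by simp
  rw [this, RatFunc.eval_algebraMap]
  simp

theorem X_sub_C_ne_zero (c : ℂ) : (RatFunc.X - RatFunc.C c : RatFunc ℂ) ≠ 0 := by
  have : (RatFunc.X - RatFunc.C c : RatFunc ℂ) =
      algebraMap (Polynomial ℂ) _ (Polynomial.X - Polynomial.C c) := by simp
  rw [this]
  exact RatFunc.algebraMap_ne_zero (Polynomial.X_sub_C_ne_zero c)

theorem eval_div {z : ℂ} (p : Polynomial ℂ) {q : Polynomial ℂ} (hq : q.eval z ≠ 0) :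
    (algebraMap _ (RatFunc ℂ) p / algebraMap _ (RatFunc ℂ) q).eval (RingHom.id ℂ) z =
      p.eval z / q.eval z := by
  have hq0 : algebraMap _ (RatFunc ℂ) q ≠ 0 := RatFunc.algebraMap_ne_zero (by rintro rfl; simp at hq)
  have := (evalAt z).map_mul ⟨_, div_mem_localRing p hq⟩ ⟨_, algebraMap_mem_localRing z q⟩
  simp only [evalAt_apply, MulMemClass.mk_mul_mk, div_mul_cancel₀ _ hq0, RatFunc.eval_algebraMap] at this
  rw [eq_div_iff hq]
  simpa [Polynomial.eval₂_id] using this.symm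

theorem inv_mem_localRing {z : ℂ} {f : RatFunc ℂ} (hf : f.eval (RingHom.id ℂ) z ≠ 0) :
    f⁻¹ ∈ localRing z := by
  have h0 : f.num.eval z ≠ 0 := by
    intro h
    apply hf
    rw [RatFunc.eval, Polynomial.eval₂_id, h, zero_div]
  rw [← RatFunc.num_div_denom f, inv_div]
  exact div_mem_localRing _ h0

/-- A regular function vanishing at `z` is divisible by the local parameter at `z`. -/
theorem exists_eq_mul_of_eval_eq_zero {z : ℂ} {f : RatFunc ℂ} (hf : f ∈ localRing z)
    (h0 : f.eval (RingHom.id ℂ) z = 0) :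
    ∃ g ∈ localRing z, f = (RatFunc.X - RatFunc.C z) * g := by
  have hn : f.num.eval z = 0 := by
    rw [RatFunc.eval, Polynomial.eval₂_id, Polynomial.eval₂_id, div_eq_zero_iff] at h0
    exact h0.resolve_right hf
  obtain ⟨r, hr⟩ := Polynomial.dvd_iff_isRoot.mpr hn
  refine ⟨_, div_mem_localRing r hf, ?_⟩
  conv_lhs => rw [← RatFunc.num_div_denom f, hr]
  simp [mul_div_assoc]

theorem eq_zero_of_infinite {f : RatFunc ℂ} {S : Set ℂ} (hS : S.Infinite)
    (h : ∀ z ∈ S, f ∈ localRing z ∧ f.eval (RingHom.id ℂ) z = 0) : f = 0 := by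
  rw [← RatFunc.num_eq_zero_iff]
  refine Polynomial.eq_zero_of_infinite_isRoot _ (hS.mono fun z hz => ?_)
  obtain ⟨h1, h2⟩ := h z hz
  rw [RatFunc.eval, Polynomial.eval₂_id, Polynomial.eval₂_id, div_eq_zero_iff] at h2
  exact h2.resolve_right h1

theorem finite_poles (f : RatFunc ℂ) : {z | f ∉ localRing z}.Finite := by
  refine (Polynomial.finite_setOfPred_isRoot (RatFunc.denom_ne_zero f)).subset fun z hz => ?_
  simpa [mem_localRing] using hz

/-! ### Conjugation of coefficients -/

/-- Complex conjugation of the coefficients of a rational function. -/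
noncomputable def ratConj : RatFunc ℂ →+* RatFunc ℂ :=
  RatFunc.mapRingHom (Polynomial.mapRingHom (starRingEnd ℂ))
    (nonZeroDivisors_le_comap_nonZeroDivisors_of_injective _
      (Polynomial.map_injective _ (starRingEnd ℂ).injective))

theorem ratConj_algebraMap (p : Polynomial ℂ) :
    ratConj (algebraMap _ (RatFunc ℂ) p) = algebraMap _ _ (p.map (starRingEnd ℂ)) := by
  have := RatFunc.map_apply_div (Polynomial.mapRingHom (starRingEnd ℂ))
    (nonZeroDivisors_le_comap_nonZeroDivisors_of_injective _
      (Polynomial.map_injective _ (starRingEnd ℂ).injective)) p 1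
  rw [map_one, map_one, map_one, div_one, div_one] at this
  exact this

theorem ratConj_C (c : ℂ) : ratConj (RatFunc.C c) = RatFunc.C (starRingEnd ℂ c) := by
  rw [← RatFunc.algebraMap_C, ratConj_algebraMap]; simp

theorem ratConj_X : ratConj RatFunc.X = RatFunc.X := by
  rw [← RatFunc.algebraMap_X, ratConj_algebraMap]; simp

theorem eval_map_conj (p : Polynomial ℂ) (z : ℂ) :
    (p.map (starRingEnd ℂ)).eval (starRingEnd ℂ z) = starRingEnd ℂ (p.eval z) := by
  rw [Polynomial.eval_map_apply]

theorem ratConj_eq (f : RatFunc ℂ) : ratConj f =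
    algebraMap _ _ (f.num.map (starRingEnd ℂ)) / algebraMap _ _ (f.denom.map (starRingEnd ℂ)) := by
  conv_lhs => rw [← RatFunc.num_div_denom f]
  rw [map_div₀, ratConj_algebraMap, ratConj_algebraMap]

theorem ratConj_mem {z : ℂ} {f : RatFunc ℂ} (hf : f ∈ localRing z) :
    ratConj f ∈ localRing (starRingEnd ℂ z) := by
  rw [ratConj_eq]
  refine div_mem_localRing _ ?_
  rw [eval_map_conj]
  exact (map_ne_zero _).mpr hf

theorem eval_ratConj {z : ℂ} {f : RatFunc ℂ} (hf : f ∈ localRing z) :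
    (ratConj f).eval (RingHom.id ℂ) (starRingEnd ℂ z) =
      starRingEnd ℂ (f.eval (RingHom.id ℂ) z) := by
  rw [ratConj_eq, eval_div, eval_map_conj, eval_map_conj, RatFunc.eval, map_div₀,
    Polynomial.eval₂_id, Polynomial.eval₂_id]
  rw [eval_map_conj]
  exact (map_ne_zero _).mpr hf

/-! ### Regular matrices and their values -/

theorem RegularAt.exists_lift {g : RatMat} {z : ℂ} (hg : RegularAt g z) :
    ∃ G : Matrix (Fin 7) (Fin 7) (localRing z),
      G.map (localRing z).subtype = g ∧ G.map (evalAt z) = value g z :=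
  ⟨fun i j => ⟨g i j, hg i j⟩, rfl, rfl⟩

theorem value_map {z : ℂ} (G : Matrix (Fin 7) (Fin 7) (localRing z)) :
    value (G.map (localRing z).subtype) z = G.map (evalAt z) := rfl

theorem RegularAt.mul {g h : RatMat} {z : ℂ} (hg : RegularAt g z) (hh : RegularAt h z) :
    RegularAt (g * h) z := fun i j => by
  rw [← mem_localRing, Matrix.mul_apply]
  exact sum_mem fun k _ => mul_mem (hg i k) (hh k j)

theorem RegularAt.add {g h : RatMat} {z : ℂ} (hg : RegularAt g z) (hh : RegularAt h z) :
    RegularAt (g + h) z := fun i j => (localRing z).add_mem (hg i j) (hh i j)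

theorem RegularAt.smul {g : RatMat} {z : ℂ} {c : RatFunc ℂ} (hc : c ∈ localRing z)
    (hg : RegularAt g z) : RegularAt (c • g) z := fun i j => (localRing z).mul_mem hc (hg i j)

theorem RegularAt.transpose {g : RatMat} {z : ℂ} (hg : RegularAt g z) : RegularAt gᵀ z :=
  fun i j => hg j i

theorem regularAt_constMat (A : Mat7) (z : ℂ) : RegularAt (constMat A) z :=
  fun i j => C_mem_localRing z (A i j)

theorem value_mul {g h : RatMat} {z : ℂ} (hg : RegularAt g z) (hh : RegularAt h z) :
    value (g * h) z = value g z * value h z := by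
  obtain ⟨G, rfl, hG⟩ := hg.exists_lift
  obtain ⟨H, rfl, hH⟩ := hh.exists_lift
  rw [← Matrix.map_mul, value_map, Matrix.map_mul, hG, hH]

theorem value_smul {g : RatMat} {z : ℂ} {c : RatFunc ℂ} (hc : c ∈ localRing z)
    (hg : RegularAt g z) : value (c • g) z = c.eval (RingHom.id ℂ) z • value g z := by
  ext i j
  exact RatFunc.eval_mul _ _ hc (hg i j)

theorem value_add {g h : RatMat} {z : ℂ} (hg : RegularAt g z) (hh : RegularAt h z) :
    value (g + h) z = value g z + value h z := by
  ext i j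
  exact RatFunc.eval_add _ _ (hg i j) (hh i j)

theorem value_constMat (A : Mat7) (z : ℂ) : value (constMat A) z = A := by
  ext i j; simp [value, constMat]

theorem value_one (z : ℂ) : value 1 z = 1 := by
  ext i j
  obtain rfl | h := eq_or_ne i j <;> simp [value, *]

theorem value_transpose (g : RatMat) (z : ℂ) : value gᵀ z = (value g z)ᵀ := rfl

theorem det_value {g : RatMat} {z : ℂ} (hg : RegularAt g z) :
    g.det ∈ localRing z ∧ (value g z).det = g.det.eval (RingHom.id ℂ) z := by
  obtain ⟨G, rfl, hG⟩ := hg.exists_lift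
  have h1 : (G.map (localRing z).subtype).det = (localRing z).subtype G.det :=
    (RingHom.map_det _ _).symm
  have h2 : (G.map (evalAt z)).det = evalAt z G.det := (RingHom.map_det _ _).symm
  rw [← hG, h1, h2]
  exact ⟨G.det.2, rfl⟩

/-- The identities over ℂ(λ) descend to the local ring at z, because the inclusion is injective, and
are then pushed forward by evaluation. -/
theorem IsOctAut.value {g : RatMat} (h : IsOctAut g) {z : ℂ} (hg : RegularAt g z) :
    IsOctAut (value g z) := by
  obtain ⟨G, rfl, hG⟩ := hg.exists_lift
  rw [← hG]
  exact (h.of_map (φ := (localRing z).subtype) Subtype.val_injective).map _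

theorem IsOctAut.holomorphicAt {g : RatMat} (h : IsOctAut g) {z : ℂ} (hg : RegularAt g z) :
    HolomorphicAt G2 g z := ⟨hg, mem_G2_iff.mpr (h.value hg)⟩

theorem value_orth {g : RatMat} (h : gᵀ * g = 1) {z : ℂ} (hg : RegularAt g z) :
    (value g z)ᵀ * value g z = 1 := by
  rw [← value_transpose, ← value_mul hg.transpose hg, h, value_one]

theorem finite_not_regularAt (g : RatMat) : {z | ¬ RegularAt g z}.Finite := by
  refine (Set.finite_iUnion fun i => Set.finite_iUnion fun j => finite_poles (g i j)).subset
    fun z hz => ?_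
  obtain ⟨i, hi⟩ := not_forall.mp hz
  obtain ⟨j, hj⟩ := not_forall.mp hi
  exact Set.mem_iUnion₂.mpr ⟨i, j, hj⟩

theorem eventually_regularAt (g : RatMat) : ∀ᶠ z in Bornology.cobounded ℂ, RegularAt g z := by
  have := (finite_not_regularAt g).isBounded
  rw [Bornology.isBounded_def] at this
  filter_upwards [this] with z hz
  exact not_not.mp hz

theorem eventually_mem_localRing (f : RatFunc ℂ) :
    ∀ᶠ z in Bornology.cobounded ℂ, f ∈ localRing z := by
  have := (finite_poles f).isBounded
  rw [Bornology.isBounded_def] at this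
  filter_upwards [this] with z hz
  exact not_not.mp hz

/-- Identity theorem: each entry of the defining equations is a rational function that is regular
and zero at infinitely many points. -/
theorem isOctAut_of_infinite {g : RatMat} {S : Set ℂ} (hS : S.Infinite)
    (h : ∀ z ∈ S, HolomorphicAt G2 g z) : IsOctAut g := by
  rw [isOctAut_iff_single]
  constructor
  · ext i j
    rw [← sub_eq_zero]
    refine eq_zero_of_infinite hS fun z hz => ?_
    obtain ⟨hr, hv⟩ := h z hz
    rw [mem_G2_iff] at hv
    obtain ⟨G, rfl, hG⟩ := hr.exists_lift
    rw [← hG] at hv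
    have e : ((G.map (localRing z).subtype)ᵀ * G.map (localRing z).subtype) i j -
        (1 : RatMat) i j = (localRing z).subtype ((Gᵀ * G) i j - (1 : Matrix _ _ _) i j) := by
      rw [map_sub, ← transpose_map, ← Matrix.map_mul, Matrix.map_apply,
        ← Matrix.map_one (localRing z).subtype (map_zero _) (map_one _), Matrix.map_apply]
    rw [e]
    refine ⟨SetLike.coe_mem ((Gᵀ * G) i j - (1 : Matrix _ _ _) i j), ?_⟩
    change evalAt z ((Gᵀ * G) i j - (1 : Matrix _ _ _) i j) = 0
    have := congrFun (congrFun hv.orth i) j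
    rw [← transpose_map, ← Matrix.map_mul,
      ← Matrix.map_one (evalAt z) (map_zero _) (map_one _)] at this
    rw [map_sub, sub_eq_zero]
    exact this
  · intro i j
    ext k
    rw [← sub_eq_zero]
    refine eq_zero_of_infinite hS fun z hz => ?_
    obtain ⟨hr, hv⟩ := h z hz
    rw [mem_G2_iff] at hv
    obtain ⟨G, rfl, hG⟩ := hr.exists_lift
    rw [← hG] at hv
    have e := comp_mulVec_cross_single (localRing z).subtype G i j
    have e' := comp_cross_mulVec_single (localRing z).subtype G i j
    have f := comp_mulVec_cross_single (evalAt z) G i j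
    have f' := comp_cross_mulVec_single (evalAt z) G i j
    rw [← e, ← e']
    refine ⟨SetLike.coe_mem ((G *ᵥ cross (Pi.single i 1) (Pi.single j 1)) k -
      cross (G *ᵥ Pi.single i 1) (G *ᵥ Pi.single j 1) k), ?_⟩
    change evalAt z ((G *ᵥ cross (Pi.single i 1) (Pi.single j 1)) k -
      cross (G *ᵥ Pi.single i 1) (G *ᵥ Pi.single j 1) k) = 0
    rw [map_sub, sub_eq_zero]
    have := congrFun (f.trans ((hv.map_cross _ _).trans f'.symm)) k
    exact this

/-! ### Negative real loops -/

/-- The algebraic form of a negative real loop in `𝔾₂`. -/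
structure IsAlgLoop (g : RatMat) : Prop where
  aut : IsOctAut g
  real : g.map ratConj = g
  neg : Tendsto (value g) (Bornology.cobounded ℂ) (nhds 1)

theorem infinite_inter_conj {U : Set ℂ} (hU : IsOpen U) (hd : Dense U) {g : RatMat} :
    {z | z ∈ U ∧ RegularAt g z ∧ RegularAt g (starRingEnd ℂ z)}.Infinite := by
  have hinf : U.Infinite := by
    obtain ⟨z, hz⟩ := hd.nonempty
    exact infinite_of_mem_nhds z (hU.mem_nhds hz)
  have h1 := finite_not_regularAt g
  have h2 : {z | ¬ RegularAt g (starRingEnd ℂ z)}.Finite :=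
    h1.preimage (starRingEnd ℂ).injective.injOn
  refine (hinf.sdiff (h1.union h2)).mono fun z hz => ?_
  have := hz.2
  simp only [Set.mem_union, Set.mem_ofPred_eq, not_or, not_not] at this
  exact ⟨hz.1, this.1, this.2⟩

theorem IsNegRealLoop.isAlgLoop {g : RatMat} (h : IsNegRealLoop G2 g) : IsAlgLoop g := by
  obtain ⟨U, hU, hd, hol⟩ := h.loop
  have hS := infinite_inter_conj hU hd (g := g)
  refine ⟨isOctAut_of_infinite hS fun z hz => hol z hz.1, ?_, h.neg⟩
  ext i j
  rw [← sub_eq_zero, Matrix.map_apply]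
  refine eq_zero_of_infinite hS fun z ⟨hz, h1, h2⟩ => ?_
  have h3 : ratConj (g i j) ∈ localRing z := by
    simpa using ratConj_mem (z := starRingEnd ℂ z) (h2 i j)
  refine ⟨sub_mem h3 (h1 i j), ?_⟩
  have e : evalAt z (⟨_, h3⟩ - ⟨_, h1 i j⟩) = evalAt z ⟨_, h3⟩ - evalAt z ⟨_, h1 i j⟩ := map_sub _ _ _
  refine e.trans (sub_eq_zero.mpr ?_)
  have e2 := eval_ratConj (z := starRingEnd ℂ z) (h2 i j)
  rw [Complex.conj_conj] at e2
  exact e2.trans (congrFun (congrFun (h.real z h1 h2) i) j)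

theorem RegularAt.conj {g : RatMat} {z : ℂ} (hg : RegularAt g z) :
    RegularAt (g.map ratConj) (starRingEnd ℂ z) := fun i j => ratConj_mem (hg i j)

theorem IsAlgLoop.isNegRealLoop {g : RatMat} (h : IsAlgLoop g) : IsNegRealLoop G2 g where
  loop := ⟨{z | ¬ RegularAt g z}ᶜ, (finite_not_regularAt g).isClosed.isOpen_compl,
    (finite_not_regularAt g).countable.dense_compl ℂ, fun z hz => h.aut.holomorphicAt (not_not.mp hz)⟩
  real z h1 h2 := by
    ext i j
    have := eval_ratConj (z := starRingEnd ℂ z) (h2 i j)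
    rw [Complex.conj_conj, show ratConj (g i j) = g i j from congrFun (congrFun h.real i) j] at this
    exact this.symm
  neg := h.neg

theorem tendsto_value_mul {g h : RatMat}
    (hg : Tendsto (value g) (Bornology.cobounded ℂ) (nhds 1))
    (hh : Tendsto (value h) (Bornology.cobounded ℂ) (nhds 1)) :
    Tendsto (value (g * h)) (Bornology.cobounded ℂ) (nhds 1) := by
  have := hg.mul hh
  rw [Matrix.one_mul] at this
  refine this.congr' ?_
  filter_upwards [eventually_regularAt g, eventually_regularAt h] with z h1 h2
  exact (value_mul h1 h2).symm

theorem tendsto_value_transpose {g : RatMat}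
    (hg : Tendsto (value g) (Bornology.cobounded ℂ) (nhds 1)) :
    Tendsto (value gᵀ) (Bornology.cobounded ℂ) (nhds 1) := by
  have h1 : Tendsto (fun A : Mat7 => Aᵀ) (nhds 1) (nhds 1) :=
    (continuous_id.matrix_transpose).tendsto' _ _ transpose_one
  exact h1.comp hg

theorem IsAlgLoop.mul {g h : RatMat} (hg : IsAlgLoop g) (hh : IsAlgLoop h) : IsAlgLoop (g * h) :=
  ⟨hg.aut.mul hh.aut, by rw [Matrix.map_mul, hg.real, hh.real], tendsto_value_mul hg.neg hh.neg⟩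

theorem IsAlgLoop.transpose {g : RatMat} (hg : IsAlgLoop g) : IsAlgLoop gᵀ :=
  ⟨hg.aut.transpose, by rw [transpose_map, hg.real], tendsto_value_transpose hg.neg⟩

/-- Orthogonality makes the determinant ±1 in the field of rational functions, hence constant; the
limit at infinity excludes −1. -/
theorem det_eq_one_of_tendsto {g : RatMat} (hg : gᵀ * g = 1)
    (hn : Tendsto (value g) (Bornology.cobounded ℂ) (nhds 1)) : g.det = 1 := by
  have h1 : g.det * g.det = 1 := by
    have := congrArg det hg
    rwa [det_mul, det_transpose, det_one] at this
  refine (mul_self_eq_one_iff.mp h1).resolve_right fun hneg => ?_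
  have h2 : Tendsto (fun A : Mat7 => A.det) (nhds 1) (nhds 1) :=
    (continuous_id.matrix_det).tendsto' _ _ det_one
  have h3 : Tendsto (fun _ : ℂ => (-1 : ℂ)) (Bornology.cobounded ℂ) (nhds 1) := by
    refine (h2.comp hn).congr' ?_
    filter_upwards [eventually_regularAt g] with z hz
    have := (det_value hz).2
    rw [hneg, show (-1 : RatFunc ℂ) = RatFunc.C (-1) by simp, RatFunc.eval_C] at this
    exact this
  have := tendsto_nhds_unique h3 tendsto_const_nhds
  norm_num at this

/-! ### Lines and projections in coordinates -/

/-- The line spanned by a coordinate vector. -/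
noncomputable def line (l : Fin 7 → ℂ) : Submodule ℂ C7 := Submodule.span ℂ {WithLp.toLp 2 l}

theorem mem_line {l : Fin 7 → ℂ} {x : C7} : x ∈ line l ↔ ∃ c : ℂ, x = WithLp.toLp 2 (c • l) := by
  rw [line, Submodule.mem_span_singleton]
  exact exists_congr fun c => eq_comm

theorem self_mem_line (l : Fin 7 → ℂ) : WithLp.toLp 2 l ∈ line l :=
  Submodule.mem_span_singleton_self _

theorem map_act_line (A : Mat7) (l : Fin 7 → ℂ) : (line l).map (act A) = line (A *ᵥ l) := by
  rw [line, Submodule.map_span, Set.image_singleton]; rfl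

theorem conjSub_line (l : Fin 7 → ℂ) : conjSub (line l) = line (star l) := by
  ext x
  change conjVec x ∈ line l ↔ _
  rw [mem_line, mem_line]
  constructor
  · rintro ⟨c, hc⟩
    refine ⟨star c, ?_⟩
    have h1 : ∀ i, star (x i) = c * l i := fun i => congrFun (congrArg WithLp.ofLp hc) i
    ext i
    have := congrArg star (h1 i)
    simpa using this
  · rintro ⟨c, rfl⟩
    refine ⟨star c, ?_⟩
    ext i
    simp [conjVec]

open scoped ComplexOrder in
theorem dotProduct_star_self_ne_zero {l : Fin 7 → ℂ} (hl : l ≠ 0) : l ⬝ᵥ star l ≠ 0 :=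
  fun h => hl (dotProduct_self_star_eq_zero.mp h)

theorem star_dotProduct_star_eq_zero {x y : Fin 7 → ℂ} (h : x ⬝ᵥ y = 0) :
    star x ⬝ᵥ star y = 0 := by
  rw [star_dotProduct_star, dotProduct_comm, h, star_zero]

theorem isIsotropicLine_iff {L : Submodule ℂ C7} :
    IsIsotropicLine L ↔ ∃ l : Fin 7 → ℂ, l ≠ 0 ∧ l ⬝ᵥ l = 0 ∧ L = line l := by
  constructor
  · rintro ⟨h1, h2⟩
    obtain ⟨v, hv, hL⟩ := finrank_eq_one_iff'.mp h1
    have hLv : L = line v.1.ofLp := by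
      refine le_antisymm (fun x hx => ?_) ?_
      · obtain ⟨c, hc⟩ := hL ⟨x, hx⟩
        exact mem_line.mpr ⟨c, (congrArg Subtype.val hc).symm⟩
      · rw [line, Submodule.span_singleton_le_iff_mem]; exact v.2
    refine ⟨v.1.ofLp, fun h => hv (Subtype.ext (WithLp.ofLp_injective 2 h)), ?_, hLv⟩
    exact h2 v.1 v.2 v.1 v.2
  · rintro ⟨l, hl, h0, rfl⟩
    refine ⟨finrank_span_singleton fun h => hl (congrArg WithLp.ofLp h), ?_⟩
    intro x hx y hy
    obtain ⟨c, rfl⟩ := mem_line.mp hx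
    obtain ⟨d, rfl⟩ := mem_line.mp hy
    simp [bil_eq, h0]

theorem mem_bilPerp_line {l : Fin 7 → ℂ} {x : C7} :
    x ∈ bilPerp (line l) ↔ x.ofLp ⬝ᵥ l = 0 := by
  constructor
  · intro h
    exact h _ (self_mem_line l)
  · intro h y hy
    obtain ⟨c, rfl⟩ := mem_line.mp hy
    simp [bil_eq, h]

theorem mem_midSpace_line {l : Fin 7 → ℂ} {x : C7} :
    x ∈ midSpace (line l) ↔ x.ofLp ⬝ᵥ l = 0 ∧ x.ofLp ⬝ᵥ star l = 0 := by
  rw [← mem_bilPerp_line, ← mem_bilPerp_line, ← conjSub_line]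
  constructor
  · intro h
    exact ⟨fun y hy => h y (Submodule.mem_sup_left hy), fun y hy => h y (Submodule.mem_sup_right hy)⟩
  · rintro ⟨h1, h2⟩ y hy
    obtain ⟨a, ha, b, hb, rfl⟩ := Submodule.mem_sup.mp hy
    have e1 : x.ofLp ⬝ᵥ a.ofLp = 0 := h1 a ha
    have e2 : x.ofLp ⬝ᵥ b.ofLp = 0 := h2 b hb
    rw [bil_eq, WithLp.ofLp_add, dotProduct_add, e1, e2, add_zero]

theorem projMat_mulVec (W : Submodule ℂ C7) (x : Fin 7 → ℂ) :
    projMat W *ᵥ x = (W.starProjection (WithLp.toLp 2 x)).ofLp := by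
  have : Matrix.toEuclideanLin (projMat W) = (W.starProjection : C7 →ₗ[ℂ] C7) :=
    Matrix.toEuclideanLin.apply_symm_apply _
  exact congrArg WithLp.ofLp (LinearMap.congr_fun this (WithLp.toLp 2 x))

theorem projMat_eq {W : Submodule ℂ C7} {A : Mat7} (hA : ∀ x, WithLp.toLp 2 (A *ᵥ x) ∈ W)
    (h : ∀ x, ∀ y ∈ W, (x - A *ᵥ x) ⬝ᵥ star y.ofLp = 0) : projMat W = A := by
  refine Matrix.ext_of_mulVec_single fun i => ?_
  rw [projMat_mulVec, Submodule.eq_starProjection_of_mem_of_inner_eq_zero (hA _)]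
  intro y hy
  rw [← inner_conj_symm, EuclideanSpace.inner_eq_star_dotProduct]
  have := h (Pi.single i 1) y hy
  simp only [WithLp.ofLp_sub, this, map_zero]

theorem projMat_line {l : Fin 7 → ℂ} (hl : l ≠ 0) :
    projMat (line l) = (l ⬝ᵥ star l)⁻¹ • vecMulVec l (star l) := by
  have hn := dotProduct_star_self_ne_zero hl
  apply projMat_eq
  · intro x
    refine mem_line.mpr ⟨(l ⬝ᵥ star l)⁻¹ * (star l ⬝ᵥ x), ?_⟩
    simp [smul_mulVec, vecMulVec_mulVec, smul_smul]
  · intro x y hy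
    obtain ⟨c, rfl⟩ := mem_line.mp hy
    simp only [smul_mulVec, vecMulVec_mulVec, dotProduct_comm (star l) x, star_smul,
      dotProduct_smul, sub_dotProduct, smul_dotProduct, op_smul_eq_smul, smul_eq_mul]
    field_simp
    ring

theorem projMat_midSpace_line {l : Fin 7 → ℂ} (hl : l ≠ 0) (h0 : l ⬝ᵥ l = 0) :
    projMat (midSpace (line l)) = 1 - (l ⬝ᵥ star l)⁻¹ • vecMulVec l (star l)
      - (l ⬝ᵥ star l)⁻¹ • vecMulVec (star l) l := by
  have hn := dotProduct_star_self_ne_zero hl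
  have h0' := star_dotProduct_star_eq_zero h0
  apply projMat_eq
  · intro x
    rw [mem_midSpace_line]
    simp only [sub_mulVec, smul_mulVec, vecMulVec_mulVec, h0, h0', dotProduct_comm (star l) x,
      dotProduct_comm (star l) l, dotProduct_comm l x, sub_dotProduct, smul_dotProduct,
      op_smul_eq_smul, smul_eq_mul, one_mulVec]
    constructor <;> field_simp <;> ring
  · intro x y hy
    rw [mem_midSpace_line] at hy
    have e1 : star l ⬝ᵥ star y.ofLp = 0 := by
      rw [star_dotProduct_star, hy.1, star_zero]
    have e2 : l ⬝ᵥ star y.ofLp = 0 := by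
      rw [← star_star l, star_dotProduct_star, hy.2, star_zero]
    simp [sub_mulVec, smul_mulVec, vecMulVec_mulVec, e1, e2]

/-- A constant vector of rational functions. -/
noncomputable def constVec (l : Fin 7 → ℂ) : Fin 7 → RatFunc ℂ := RatFunc.C ∘ l

theorem constVec_dotProduct (x y : Fin 7 → ℂ) :
    constVec x ⬝ᵥ constVec y = RatFunc.C (x ⬝ᵥ y) := by
  simp [constVec, dotProduct]

theorem constMat_vecMulVec (x y : Fin 7 → ℂ) :
    constMat (vecMulVec x y) = vecMulVec (constVec x) (constVec y) := by
  ext i j; simp [constMat, constVec, vecMulVec_apply]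

theorem simpleElt_line (α : ℂ) {l : Fin 7 → ℂ} (hl : l ≠ 0) (h0 : l ⬝ᵥ l = 0) :
    simpleElt α (line l) = simpleMat (moeb α) (constVec l) (constVec (star l)) := by
  have hl' : star l ≠ 0 := star_ne_zero.mpr hl
  have e : ∀ (c : ℂ) (A : Mat7), constMat (c • A) = RatFunc.C c • constMat A := fun c A => by
    ext i j; simp [constMat]
  have e1 : ∀ A B : Mat7, constMat (A - B) = constMat A - constMat B := fun A B => by
    ext i j; simp [constMat]
  have e2 : constMat (1 : Mat7) = 1 :=
    Matrix.map_one _ (map_zero RatFunc.C) (map_one RatFunc.C)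
  rw [simpleElt, conjSub_line, projMat_line hl, projMat_line hl', projMat_midSpace_line hl h0,
    simpleMat, star_star, e1, e1, e, e, e, e2, constMat_vecMulVec, constMat_vecMulVec,
    constVec_dotProduct, dotProduct_comm (star l) l, map_inv₀]
  ext i j
  simp only [Matrix.add_apply, Matrix.sub_apply, Matrix.smul_apply, smul_eq_mul]
  ring

/-- The component in `(L ⊕ L̄)^⊥` of a vector `k` orthogonal to `l̄`. -/
noncomputable def midPart (l k : Fin 7 → ℂ) : Fin 7 → ℂ :=
  k - ((l ⬝ᵥ k) / (l ⬝ᵥ star l)) • star l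

/-- The `𝔾₂` pair condition for spanning vectors. -/
structure IsG2VecPair (l k : Fin 7 → ℂ) : Prop where
  left_ne : l ≠ 0
  right_ne : k ≠ 0
  left_null : l ⬝ᵥ l = 0
  right_null : k ⬝ᵥ k = 0
  perp : k ⬝ᵥ star l = 0
  mid_ne : midPart l k ≠ 0
  cross : cross l (midPart l k) = 0

theorem midPart_dotProduct_star {l k : Fin 7 → ℂ} (h0 : l ⬝ᵥ l = 0) (h : k ⬝ᵥ star l = 0) :
    midPart l k ⬝ᵥ star l = 0 := by
  simp [midPart, h, star_dotProduct_star_eq_zero h0]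

theorem midPart_dotProduct_left {l : Fin 7 → ℂ} (hl : l ≠ 0) (k : Fin 7 → ℂ) :
    midPart l k ⬝ᵥ l = 0 := by
  have hn := dotProduct_star_self_ne_zero hl
  simp only [midPart, sub_dotProduct, smul_dotProduct, smul_eq_mul, dotProduct_comm (star l) l,
    dotProduct_comm k l]
  field_simp
  ring

theorem midPart_dotProduct_self {l k : Fin 7 → ℂ} (h0 : l ⬝ᵥ l = 0) (k0 : k ⬝ᵥ k = 0)
    (h : k ⬝ᵥ star l = 0) : midPart l k ⬝ᵥ midPart l k = 0 := by
  simp [midPart, h, k0, star_dotProduct_star_eq_zero h0, dotProduct_comm (star l) k]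

theorem IsG2VecPair.isNullPair {l k : Fin 7 → ℂ} (h : IsG2VecPair l k) :
    IsNullPair l (midPart l k) :=
  ⟨h.left_null, by rw [dotProduct_comm, midPart_dotProduct_left h.left_ne],
    midPart_dotProduct_self h.left_null h.right_null h.perp, h.cross⟩

/-- The number k·l̄ is the Hermitian product of k with l. When it vanishes, only the l̄-component
has to be removed. -/
theorem starProjection_midSpace {l k : Fin 7 → ℂ} (hl : l ≠ 0) (h0 : l ⬝ᵥ l = 0)
    (h : k ⬝ᵥ star l = 0) : ((midSpace (line l)).starProjection : C7 →ₗ[ℂ] C7)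
      (WithLp.toLp 2 k) = WithLp.toLp 2 (midPart l k) := by
  apply WithLp.ofLp_injective 2
  refine (projMat_mulVec _ _).symm.trans ?_
  rw [projMat_midSpace_line hl h0]
  simp [sub_mulVec, smul_mulVec, vecMulVec_mulVec, dotProduct_comm (star l) k, h, midPart,
    smul_smul, div_eq_inv_mul]

theorem isG2Pair_line_iff {l k : Fin 7 → ℂ} (hl : l ≠ 0) (hk : k ≠ 0) (h0 : l ⬝ᵥ l = 0)
    (k0 : k ⬝ᵥ k = 0) : IsG2Pair (line l) (line k) ↔ IsG2VecPair l k := by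
  have hperp : line k ≤ bilPerp (conjSub (line l)) ↔ k ⬝ᵥ star l = 0 := by
    rw [conjSub_line, line, Submodule.span_singleton_le_iff_mem, mem_bilPerp_line]
  have hmap : k ⬝ᵥ star l = 0 → (line l ⊔ (line k).map
      ((midSpace (line l)).starProjection : C7 →ₗ[ℂ] C7)) =
      Submodule.span ℂ {WithLp.toLp 2 l, WithLp.toLp 2 (midPart l k)} := fun h => by
    rw [line, line, Submodule.map_span, Set.image_singleton, ← line,
      starProjection_midSpace hl h0 h, line, ← Submodule.span_union, Set.singleton_union]
  constructor
  · intro h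
    have hp := hperp.mp h.perp
    have hc := h.coassoc
    rw [hmap hp] at hc
    refine ⟨hl, hk, h0, k0, hp, fun hw => ?_, ?_⟩
    -- With zero middle part the sum would be the line of l alone, of dimension 1 instead of 2.
    · have := hc.1
      rw [hw, WithLp.toLp_zero, Set.pair_comm, Submodule.span_insert_zero, 
        finrank_span_singleton fun h => hl (congrArg WithLp.ofLp h)] at this
      norm_num at this
    · have := hc.2.2 (WithLp.toLp 2 l) (Submodule.subset_span (by simp))
        (WithLp.toLp 2 (midPart l k)) (Submodule.subset_span (by simp))
      rw [octProd_eq] at this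
      exact congrArg WithLp.ofLp this
  · intro h
    refine ⟨isIsotropicLine_iff.mpr ⟨l, hl, h0, rfl⟩, isIsotropicLine_iff.mpr ⟨k, hk, k0, rfl⟩,
      hperp.mpr h.perp, ?_⟩
    rw [hmap h.perp]
    have hN := h.isNullPair
    have hli : LinearIndependent ℂ ![WithLp.toLp 2 l, WithLp.toLp 2 (midPart l k)] := by
      refine LinearIndependent.pair_iff.mpr fun a b hab => ?_
      have h1 : a • l + b • midPart l k = 0 := congrArg WithLp.ofLp hab
      have h2 := congrArg (· ⬝ᵥ star l) h1
      simp only [add_dotProduct, smul_dotProduct, midPart_dotProduct_star h0 h.perp, mul_zero,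
        add_zero, zero_dotProduct, smul_eq_mul] at h2
      have ha := (mul_eq_zero.mp h2).resolve_right (dotProduct_star_self_ne_zero hl)
      rw [ha, zero_smul, zero_add] at h1
      exact ⟨ha, (smul_eq_zero.mp h1).resolve_right h.mid_ne⟩
    refine ⟨?_, ?_, ?_⟩
    · have := finrank_span_eq_card hli
      rwa [Matrix.range_cons, Matrix.range_cons, Matrix.range_empty, Set.union_empty,
        Set.singleton_union, Fintype.card_fin] at this
    · intro x hx y hy
      obtain ⟨a, b, rfl⟩ := Submodule.mem_span_pair.mp hx
      obtain ⟨c, d, rfl⟩ := Submodule.mem_span_pair.mp hy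
      simp [bil_eq, hN.left, hN.mid, hN.symm.mid, hN.right]
    · intro x hx y hy
      obtain ⟨a, b, rfl⟩ := Submodule.mem_span_pair.mp hx
      obtain ⟨c, d, rfl⟩ := Submodule.mem_span_pair.mp hy
      simp [octProd_eq, cross_add_left, cross_add_right, cross_smul_left, cross_smul_right,
        cross_self, hN.cross, hN.symm.cross]

/-! ### Simple elements near their poles -/

theorem sub_conj_ne_zero {α : ℂ} (hα : α.im ≠ 0) : α - starRingEnd ℂ α ≠ 0 := by
  intro h
  exact hα (Complex.conj_eq_iff_im.mp (sub_eq_zero.mp h).symm)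

theorem moeb_ne_zero (α : ℂ) : moeb α ≠ 0 := div_ne_zero (X_sub_C_ne_zero _) (X_sub_C_ne_zero _)

theorem inv_X_sub_C_conj_mem {α : ℂ} (hα : α.im ≠ 0) :
    (RatFunc.X - RatFunc.C (starRingEnd ℂ α) : RatFunc ℂ)⁻¹ ∈ localRing α := by
  refine inv_mem_localRing ?_
  rw [eval_X_sub_C]
  exact sub_conj_ne_zero hα

theorem moeb_mem {α : ℂ} (hα : α.im ≠ 0) : moeb α ∈ localRing α := by
  rw [moeb, div_eq_mul_inv]
  exact mul_mem (X_sub_C_mem_localRing _ _) (inv_X_sub_C_conj_mem hα)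

theorem eval_moeb {α : ℂ} (hα : α.im ≠ 0) : (moeb α).eval (RingHom.id ℂ) α = 0 := by
  rw [moeb, div_eq_mul_inv, RatFunc.eval_mul _ _ (X_sub_C_mem_localRing _ _)
    (inv_X_sub_C_conj_mem hα), eval_X_sub_C, sub_self, zero_mul]

theorem X_sub_C_mul_inv_moeb (α : ℂ) : (RatFunc.X - RatFunc.C α : RatFunc ℂ) * (moeb α)⁻¹ =
    RatFunc.X - RatFunc.C (starRingEnd ℂ α) := by
  have := X_sub_C_ne_zero α
  rw [moeb]; field_simp

theorem inv_moeb_mul_mem {α : ℂ} {f : RatFunc ℂ} (hf : f ∈ localRing α)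
    (h0 : f.eval (RingHom.id ℂ) α = 0) : (moeb α)⁻¹ * f ∈ localRing α := by
  obtain ⟨g, hg, rfl⟩ := exists_eq_mul_of_eval_eq_zero hf h0
  rw [← mul_assoc, mul_comm _ (RatFunc.X - RatFunc.C α), X_sub_C_mul_inv_moeb]
  exact mul_mem (X_sub_C_mem_localRing _ _) hg

theorem regularAt_inv_moeb_smul {α : ℂ} {g : RatMat} (hg : RegularAt g α) (h0 : value g α = 0) :
    RegularAt ((moeb α)⁻¹ • g) α := fun i j =>
  inv_moeb_mul_mem (hg i j) (congrFun (congrFun h0 i) j)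

/-- The matrix `l̄ lᵀ / |l|²`. -/
noncomputable def conjProj (l : Fin 7 → ℂ) : Mat7 := (l ⬝ᵥ star l)⁻¹ • vecMulVec (star l) l

/-- The simple element of the line spanned by `l`. -/
noncomputable def simpleVec (α : ℂ) (l : Fin 7 → ℂ) : RatMat :=
  simpleMat (moeb α) (constVec l) (constVec (star l))

/-- The part of the simple element of `l` that is regular at `α`. -/
noncomputable def regPart (α : ℂ) (l : Fin 7 → ℂ) : RatMat :=
  constMat (1 - conjProj l - (conjProj l)ᵀ) + moeb α • constMat (conjProj l)ᵀ

theorem simpleVec_eq (α : ℂ) (l : Fin 7 → ℂ) :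
    simpleVec α l = regPart α l + (moeb α)⁻¹ • constMat (conjProj l) := by
  ext i j
  have e1 : constMat (1 - conjProj l - (conjProj l)ᵀ) i j = (1 : RatMat) i j -
      constMat (conjProj l) i j - constMat (conjProj l)ᵀ i j := by
    by_cases h : i = j <;> simp [constMat, Matrix.one_apply, h]
  have e2 : constMat (conjProj l) i j =
      (RatFunc.C (l ⬝ᵥ star l))⁻¹ * (vecMulVec (constVec (star l)) (constVec l)) i j := by
    simp [constMat, conjProj, constVec, vecMulVec_apply]
  have e3 : constMat (conjProj l)ᵀ i j =
      (RatFunc.C (l ⬝ᵥ star l))⁻¹ * (vecMulVec (constVec l) (constVec (star l))) i j := by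
    simp [constMat, conjProj, constVec, vecMulVec_apply, mul_comm]
  simp only [simpleVec, simpleMat, regPart, Matrix.add_apply, Matrix.smul_apply, smul_eq_mul,
    e1, constVec_dotProduct]
  rw [e2, e3]
  ring

theorem regularAt_regPart {α : ℂ} (hα : α.im ≠ 0) (l : Fin 7 → ℂ) : RegularAt (regPart α l) α :=
  (regularAt_constMat _ _).add ((regularAt_constMat _ _).smul (moeb_mem hα))

theorem value_regPart {α : ℂ} (hα : α.im ≠ 0) (l : Fin 7 → ℂ) :
    value (regPart α l) α = 1 - conjProj l - (conjProj l)ᵀ := by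
  rw [regPart, value_add (regularAt_constMat _ _) ((regularAt_constMat _ _).smul (moeb_mem hα)),
    value_smul (moeb_mem hα) (regularAt_constMat _ _), eval_moeb hα, value_constMat, zero_smul,
    add_zero]

theorem simpleVec_orth (α : ℂ) {l : Fin 7 → ℂ} (hl : l ≠ 0) (h0 : l ⬝ᵥ l = 0) :
    (simpleVec α l)ᵀ * simpleVec α l = 1 := by
  refine simpleMat_transpose_mul (moeb_ne_zero α) ?_ ?_ ?_ <;> rw [constVec_dotProduct]
  · rw [h0, map_zero]
  · rw [star_dotProduct_star_eq_zero h0, map_zero]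
  · exact (map_ne_zero _).mpr (dotProduct_star_self_ne_zero hl)

theorem det_simpleVec (α : ℂ) {l : Fin 7 → ℂ} (hl : l ≠ 0) (h0 : l ⬝ᵥ l = 0) :
    (simpleVec α l).det = 1 := by
  refine det_simpleMat (moeb_ne_zero α) ?_ ?_ <;> rw [constVec_dotProduct]
  · rw [h0, map_zero]
  · exact (map_ne_zero _).mpr (dotProduct_star_self_ne_zero hl)

theorem conjProj_mulVec (l x : Fin 7 → ℂ) :
    conjProj l *ᵥ x = ((l ⬝ᵥ x) / (l ⬝ᵥ star l)) • star l := by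
  simp [conjProj, smul_mulVec, vecMulVec_mulVec, smul_smul, div_eq_inv_mul]

theorem conjProj_transpose_mulVec (l x : Fin 7 → ℂ) :
    (conjProj l)ᵀ *ᵥ x = ((star l ⬝ᵥ x) / (l ⬝ᵥ star l)) • l := by
  simp [conjProj, transpose_vecMulVec, smul_mulVec, vecMulVec_mulVec, smul_smul, div_eq_inv_mul]

theorem midProj_mulVec_self {l : Fin 7 → ℂ} (hl : l ≠ 0) (h0 : l ⬝ᵥ l = 0) :
    (1 - conjProj l - (conjProj l)ᵀ) *ᵥ l = 0 := by
  have hn := dotProduct_star_self_ne_zero hl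
  simp [sub_mulVec, conjProj_mulVec, conjProj_transpose_mulVec, h0, dotProduct_comm (star l) l, hn]

theorem midProj_transpose (l : Fin 7 → ℂ) :
    (1 - conjProj l - (conjProj l)ᵀ)ᵀ = 1 - conjProj l - (conjProj l)ᵀ := by
  simp only [transpose_sub, transpose_one, transpose_transpose]; abel

/-- The vector u = Hv is null with value k at α, so u = k + t b with t = λ − α and b regular. Since
k is null too, u·u = 0 gives 2 k·b + t b·b = 0, hence k·u = t k·b = −(t²/2) b·b, a zero of order at
least two. -/
theorem inv_moeb_mul_inv_moeb_mul_mem {α : ℂ} {H : RatMat} (hH : Hᵀ * H = 1)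
    (hr : RegularAt H α) {k v : Fin 7 → ℂ} (v0 : v ⬝ᵥ v = 0) (hkv : value H α *ᵥ v = k) :
    (moeb α)⁻¹ * ((moeb α)⁻¹ * (constVec k ⬝ᵥ (H *ᵥ constVec v))) ∈ localRing α := by
  have hu : ∀ i, ∃ b ∈ localRing α,
      (H *ᵥ constVec v) i - constVec k i = (RatFunc.X - RatFunc.C α) * b := fun i => by
    obtain ⟨G, rfl, hG⟩ := hr.exists_lift
    let V : Fin 7 → localRing α := fun i => ⟨constVec v i, C_mem_localRing _ _⟩
    have e1 := map_mulVec_comp (localRing α).subtype G V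
    have e2 := map_mulVec_comp (evalAt α) G V
    have hV : evalAt α ∘ V = v := by
      ext i; simp [V, evalAt_apply, constVec]
    rw [hG, hV, hkv] at e2
    have e3 : (G.map (localRing α).subtype *ᵥ constVec v) i - constVec k i =
        (((G *ᵥ V) i - ⟨constVec k i, C_mem_localRing _ _⟩ : localRing α) : RatFunc ℂ) := by
      rw [AddSubgroupClass.coe_sub]
      exact congrArg (· - constVec k i) (congrFun e1 i).symm
    rw [e3]
    refine exists_eq_mul_of_eval_eq_zero (SetLike.coe_mem _) ?_
    rw [← evalAt_apply, map_sub, sub_eq_zero]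
    refine (congrFun e2 i).trans ?_
    simp [evalAt_apply, constVec]
  choose b hb hub using hu
  have hu' : H *ᵥ constVec v = constVec k + (RatFunc.X - RatFunc.C α : RatFunc ℂ) • b := by
    ext i; simp only [Pi.add_apply, Pi.smul_apply, smul_eq_mul, ← hub i]; ring
  have h0 : (H *ᵥ constVec v) ⬝ᵥ (H *ᵥ constVec v) = 0 := by
    rw [transpose_mul_eq_one_iff.mp hH, constVec_dotProduct, v0, map_zero]
  have k0 : constVec k ⬝ᵥ constVec k = 0 := by
    have hk0 := transpose_mul_eq_one_iff.mp (value_orth hH hr) v v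
    rw [hkv, v0] at hk0
    rw [constVec_dotProduct, hk0, map_zero]
  rw [hu'] at h0 ⊢
  simp only [add_dotProduct, dotProduct_add, smul_dotProduct, dotProduct_smul, smul_eq_mul, k0,
    dotProduct_comm b (constVec k), zero_add] at h0 ⊢
  have ht := X_sub_C_ne_zero α
  have h2 : (RatFunc.C (1 / 2 : ℂ)) * 2 = 1 := by
    rw [show (2 : RatFunc ℂ) = RatFunc.C 2 from (map_ofNat RatFunc.C 2).symm, ← map_mul]; norm_num
  have h1 : constVec k ⬝ᵥ b =
      -RatFunc.C (1 / 2 : ℂ) * ((RatFunc.X - RatFunc.C α) * (b ⬝ᵥ b)) := by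
    have h3 : 2 * (constVec k ⬝ᵥ b) + (RatFunc.X - RatFunc.C α) * (b ⬝ᵥ b) = 0 :=
      mul_left_cancel₀ ht (by linear_combination h0)
    linear_combination RatFunc.C (1 / 2 : ℂ) * h3 - (constVec k ⬝ᵥ b) * h2
  have e : (moeb α)⁻¹ * ((moeb α)⁻¹ * ((RatFunc.X - RatFunc.C α) * (constVec k ⬝ᵥ b))) =
      -RatFunc.C (1 / 2 : ℂ) * ((RatFunc.X - RatFunc.C (starRingEnd ℂ α)) *
        (RatFunc.X - RatFunc.C (starRingEnd ℂ α)) * (b ⬝ᵥ b)) := by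
    rw [h1, ← X_sub_C_mul_inv_moeb]; ring
  rw [e]
  have hs := X_sub_C_mem_localRing α (starRingEnd ℂ α)
  exact mul_mem (neg_mem (C_mem_localRing _ _)) (mul_mem (mul_mem hs hs)
    (sum_mem fun i _ => mul_mem (hb i) (hb i)))

/-- Conjugating an orthogonal rational map by simple elements of corresponding null lines keeps
it regular. -/
theorem regularAt_dressing {α : ℂ} (hα : α.im ≠ 0) {H : RatMat} (hH : Hᵀ * H = 1)
    (hr : RegularAt H α) {k v : Fin 7 → ℂ} (hv : v ≠ 0) (v0 : v ⬝ᵥ v = 0)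
    (hk : k ≠ 0) (k0 : k ⬝ᵥ k = 0) (hkv : value H α *ᵥ v = k) :
    RegularAt (simpleVec α k * H * (simpleVec α v)ᵀ) α := by
  have hvk : (value H α)ᵀ *ᵥ k = v := by
    rw [← hkv, mulVec_mulVec, value_orth hH hr, one_mulVec]
  have hvk' : k ᵥ* value H α = v := by rw [← mulVec_transpose, hvk]
  have hNk := regularAt_regPart hα k
  have hNv := (regularAt_regPart hα v).transpose
  have hOk := regularAt_constMat (conjProj k) α
  have hOv := (regularAt_constMat (conjProj v) α).transpose
  have e : simpleVec α k * H * (simpleVec α v)ᵀ =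
      regPart α k * H * (regPart α v)ᵀ
      + (moeb α)⁻¹ • (constMat (conjProj k) * H * (regPart α v)ᵀ)
      + (moeb α)⁻¹ • (regPart α k * H * (constMat (conjProj v))ᵀ)
      + (moeb α)⁻¹ • (moeb α)⁻¹ • (constMat (conjProj k) * H * (constMat (conjProj v))ᵀ) := by
    rw [simpleVec_eq, simpleVec_eq, transpose_add, transpose_smul]
    simp only [Matrix.add_mul, Matrix.mul_add, Matrix.smul_mul, Matrix.mul_smul, smul_add]
    abel
  rw [e]
  -- The mixed terms have coefficients vanishing at α: kᵀ H(α) = vᵀ and H(α) v = k, and the middle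
  -- projections kill v and k respectively. The double-pole term is governed by kᵀ H v.
  refine (((hNk.mul hr).mul hNv).add (regularAt_inv_moeb_smul ((hOk.mul hr).mul hNv) ?_)).add
    (regularAt_inv_moeb_smul ((hNk.mul hr).mul hOv) ?_) |>.add ?_
  · rw [value_mul (hOk.mul hr) hNv, value_mul hOk hr, value_transpose, value_regPart hα,
      value_constMat, midProj_transpose,
      show conjProj k = (k ⬝ᵥ star k)⁻¹ • vecMulVec (star k) k from rfl, Matrix.smul_mul,
      Matrix.smul_mul, vecMulVec_mul, vecMulVec_mul, hvk', ← mulVec_transpose, midProj_transpose,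
      midProj_mulVec_self hv v0, vecMulVec_zero, smul_zero]
  · rw [value_mul (hNk.mul hr) hOv, value_mul hNk hr, value_transpose, value_regPart hα,
      value_constMat, show (conjProj v)ᵀ = (v ⬝ᵥ star v)⁻¹ • vecMulVec v (star v) by
        rw [conjProj, transpose_smul, transpose_vecMulVec], Matrix.mul_smul,
      mul_vecMulVec, ← mulVec_mulVec, hkv, midProj_mulVec_self hk k0, zero_vecMulVec, smul_zero]
  · have hφ := inv_moeb_mul_inv_moeb_mul_mem hH hr v0 hkv
    have e1 : constMat (conjProj k) = RatFunc.C (k ⬝ᵥ star k)⁻¹ •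
        vecMulVec (constVec (star k)) (constVec k) := by
      rw [← constMat_vecMulVec]; ext i j; simp [constMat, conjProj]
    have e2 : (constMat (conjProj v))ᵀ = RatFunc.C (v ⬝ᵥ star v)⁻¹ •
        vecMulVec (constVec v) (constVec (star v)) := by
      rw [← constMat_vecMulVec]; ext i j; simp [constMat, conjProj, vecMulVec_apply, mul_comm]
    rw [e1, e2, Matrix.smul_mul, Matrix.smul_mul, Matrix.mul_smul, Matrix.mul_assoc, mul_vecMulVec,
      vecMulVec_mul_vecMulVec, vecMulVec_smul]
    intro i j
    rw [← mem_localRing]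
    simp only [Matrix.smul_apply, smul_eq_mul, vecMulVec_apply]
    have : ∀ a b c d x y : RatFunc ℂ, a * (a * (b * (c * (d * (x * y))))) =
      b * c * (x * y) * (a * (a * d)) := fun a b c d x y => by ring
    rw [this]
    exact mul_mem (mul_mem (mul_mem (C_mem_localRing _ _) (C_mem_localRing _ _))
      (mul_mem (C_mem_localRing _ _) (C_mem_localRing _ _))) hφ

/-! ### Products of two simple elements -/

theorem regularAt_X_sub_C_smul_simpleVec {α : ℂ} (hα : α.im ≠ 0) (l : Fin 7 → ℂ) :
    RegularAt ((RatFunc.X - RatFunc.C α : RatFunc ℂ) • simpleVec α l) α ∧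
      value ((RatFunc.X - RatFunc.C α : RatFunc ℂ) • simpleVec α l) α =
        (α - starRingEnd ℂ α) • conjProj l := by
  rw [simpleVec_eq, smul_add, smul_smul, X_sub_C_mul_inv_moeb]
  have h1 := (regularAt_regPart hα l).smul (X_sub_C_mem_localRing α α)
  have h2 := (regularAt_constMat (conjProj l) α).smul
    (X_sub_C_mem_localRing α (starRingEnd ℂ α))
  refine ⟨h1.add h2, ?_⟩
  rw [value_add h1 h2, value_smul (X_sub_C_mem_localRing _ _) (regularAt_regPart hα l),
    value_smul (X_sub_C_mem_localRing _ _) (regularAt_constMat _ _), value_constMat,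
    eval_X_sub_C, eval_X_sub_C, sub_self, zero_smul, zero_add]

/-- The residue at `α`, up to a factor, of the product of the simple elements of `l` and `k`. -/
noncomputable def pairRes (l k : Fin 7 → ℂ) : Mat7 :=
  (l ⬝ᵥ star l)⁻¹ • vecMulVec (star l) (midPart k l) +
    (k ⬝ᵥ star k)⁻¹ • vecMulVec (star (midPart l k)) k

theorem dotProduct_star_eq_zero_comm {l k : Fin 7 → ℂ} (h : k ⬝ᵥ star l = 0) :
    l ⬝ᵥ star k = 0 := by
  rw [dotProduct_star, h, star_zero]

theorem star_midPart (l k : Fin 7 → ℂ) :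
    star (midPart l k) = star k - ((star l ⬝ᵥ star k) / (l ⬝ᵥ star l)) • l := by
  have e1 : star (l ⬝ᵥ k) = star l ⬝ᵥ star k := by
    rw [star_dotProduct_star, dotProduct_comm]
  have e2 : star (l ⬝ᵥ star l) = l ⬝ᵥ star l := by
    rw [← star_dotProduct_star, star_star]
  rw [midPart, star_sub, star_smul, star_star, star_div₀, e1, e2]

theorem conjProj_mul_midProj {l k : Fin 7 → ℂ} (h : k ⬝ᵥ star l = 0) :
    conjProj l * (1 - conjProj k - (conjProj k)ᵀ) =
      (l ⬝ᵥ star l)⁻¹ • vecMulVec (star l) (midPart k l) := by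
  rw [conjProj, Matrix.smul_mul, vecMulVec_mul, ← mulVec_transpose, midProj_transpose]
  congr 2
  simp [sub_mulVec, conjProj_mulVec, conjProj_transpose_mulVec, midPart,
    dotProduct_comm (star k) l, dotProduct_star_eq_zero_comm h]

theorem midProj_mul_conjProj {l k : Fin 7 → ℂ} (h : k ⬝ᵥ star l = 0) :
    (1 - conjProj l - (conjProj l)ᵀ) * conjProj k =
      (k ⬝ᵥ star k)⁻¹ • vecMulVec (star (midPart l k)) k := by
  rw [show conjProj k = (k ⬝ᵥ star k)⁻¹ • vecMulVec (star k) k from rfl, Matrix.mul_smul,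
    mul_vecMulVec]
  congr 2
  simp [sub_mulVec, conjProj_mulVec, conjProj_transpose_mulVec, star_midPart,
    dotProduct_star_eq_zero_comm h]

theorem conjProj_mul_conjProj (l k : Fin 7 → ℂ) :
    conjProj l * conjProj k =
      ((l ⬝ᵥ star l)⁻¹ * (k ⬝ᵥ star k)⁻¹ * (l ⬝ᵥ star k)) • vecMulVec (star l) k := by
  rw [conjProj, conjProj, Matrix.smul_mul, Matrix.mul_smul, vecMulVec_mul_vecMulVec,
    vecMulVec_smul, smul_smul, smul_smul]

/-- The product of the two polar parts is a multiple of l·k̄ = 0, so there is no double pole; the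
residue is the sum of the two mixed terms. -/
theorem X_sub_C_smul_pair {α : ℂ} (hα : α.im ≠ 0) {l k : Fin 7 → ℂ} (h : k ⬝ᵥ star l = 0) :
    RegularAt ((RatFunc.X - RatFunc.C α : RatFunc ℂ) • (simpleVec α l * simpleVec α k)) α ∧
      value ((RatFunc.X - RatFunc.C α : RatFunc ℂ) • (simpleVec α l * simpleVec α k)) α =
        (α - starRingEnd ℂ α) • pairRes l k := by
  have h0 : constMat (conjProj l) * constMat (conjProj k) = 0 := by
    rw [constMat, constMat, ← Matrix.map_mul, conjProj_mul_conjProj,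
      dotProduct_star_eq_zero_comm h, mul_zero, zero_smul]
    exact Matrix.map_zero _ (map_zero _)
  have e : (RatFunc.X - RatFunc.C α : RatFunc ℂ) • (simpleVec α l * simpleVec α k) =
      ((RatFunc.X - RatFunc.C α : RatFunc ℂ) • simpleVec α l) * regPart α k +
      regPart α l * ((RatFunc.X - RatFunc.C (starRingEnd ℂ α) : RatFunc ℂ) •
        constMat (conjProj k)) := by
    rw [simpleVec_eq, simpleVec_eq, ← X_sub_C_mul_inv_moeb]
    simp only [Matrix.add_mul, Matrix.mul_add, Matrix.smul_mul, Matrix.mul_smul, smul_add,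
      smul_smul, h0, smul_zero]
    abel
  have hl := regularAt_X_sub_C_smul_simpleVec hα l
  have hc := (regularAt_constMat (conjProj k) α).smul
    (X_sub_C_mem_localRing α (starRingEnd ℂ α))
  have hNk := regularAt_regPart hα k
  have hNl := regularAt_regPart hα l
  rw [e]
  refine ⟨(hl.1.mul hNk).add (hNl.mul hc), ?_⟩
  rw [value_add (hl.1.mul hNk) (hNl.mul hc), value_mul hl.1 hNk, value_mul hNl hc, hl.2,
    value_smul (X_sub_C_mem_localRing _ _) (regularAt_constMat _ _), value_constMat,
    eval_X_sub_C, value_regPart hα, value_regPart hα, Matrix.smul_mul, Matrix.mul_smul,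
    conjProj_mul_midProj h, midProj_mul_conjProj h, ← smul_add, pairRes]

/-- If the product of two simple elements has at most a simple pole, its factors satisfy the
orthogonality condition. -/
theorem dotProduct_star_eq_zero_of_regularAt {α : ℂ} (hα : α.im ≠ 0) {l k : Fin 7 → ℂ}
    (hl : l ≠ 0) (hk : k ≠ 0)
    (h : RegularAt ((RatFunc.X - RatFunc.C α : RatFunc ℂ) • (simpleVec α l * simpleVec α k)) α) :
    k ⬝ᵥ star l = 0 := by
  have h1 := regularAt_X_sub_C_smul_simpleVec hα l
  have h2 := regularAt_X_sub_C_smul_simpleVec hα k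
  -- At α, (λ − α)² times the product has as value a nonzero multiple of (l·k̄) l̄ kᵀ. By assumption
  -- one factor λ − α already clears the pole, so this value is zero.
  have e : (RatFunc.X - RatFunc.C α : RatFunc ℂ) •
      ((RatFunc.X - RatFunc.C α : RatFunc ℂ) • (simpleVec α l * simpleVec α k)) =
      ((RatFunc.X - RatFunc.C α : RatFunc ℂ) • simpleVec α l) *
        ((RatFunc.X - RatFunc.C α : RatFunc ℂ) • simpleVec α k) := by
    rw [Matrix.smul_mul, Matrix.mul_smul]
  have e2 := value_smul (X_sub_C_mem_localRing α α) h
  rw [e, value_mul h1.1 h2.1, h1.2, h2.2, eval_X_sub_C, sub_self, zero_smul, Matrix.smul_mul,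
    Matrix.mul_smul, conjProj_mul_conjProj] at e2
  have hs := sub_conj_ne_zero hα
  have hvv : vecMulVec (star l) k ≠ 0 := by
    obtain ⟨i, hi⟩ := Function.ne_iff.mp hl
    obtain ⟨j, hj⟩ := Function.ne_iff.mp hk
    intro h0
    have := congrFun (congrFun h0 i) j
    rw [vecMulVec_apply] at this
    exact mul_ne_zero (star_ne_zero.mpr hi) hj this
  simp only [smul_eq_zero, hs, hvv, mul_eq_zero, inv_eq_zero, dotProduct_star_self_ne_zero hl,
    dotProduct_star_self_ne_zero hk, false_or, or_false] at e2
  exact dotProduct_star_eq_zero_comm e2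

/-! ### Symmetry of the pair condition -/

theorem midPart_eq (l k : Fin 7 → ℂ) :
    k = midPart l k + ((l ⬝ᵥ k) / (l ⬝ᵥ star l)) • star l := by
  rw [midPart, sub_add_cancel]

theorem star_eq_star_midPart (l k : Fin 7 → ℂ) :
    star k = star (midPart l k) + ((star l ⬝ᵥ star k) / (l ⬝ᵥ star l)) • l := by
  rw [star_midPart, sub_add_cancel]

theorem star_midPart_dotProduct {l k : Fin 7 → ℂ} (h0 : l ⬝ᵥ l = 0) (h : k ⬝ᵥ star l = 0) :
    l ⬝ᵥ star (midPart l k) = 0 :=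
  dotProduct_star_eq_zero_comm (midPart_dotProduct_star h0 h)

/-- Expresses the middle part of l relative to k through l and w̄, where w = `midPart l k`; their
products with k = w + a l̄ are controlled by the null pairs (l, w) and (l̄, w̄). -/
theorem smul_midPart_swap {l k : Fin 7 → ℂ} (hl : l ≠ 0) (hk : k ≠ 0) :
    (k ⬝ᵥ star k) • midPart k l =
      (midPart l k ⬝ᵥ star (midPart l k)) • l - (l ⬝ᵥ k) • star (midPart l k) := by
  have hn := dotProduct_star_self_ne_zero hl
  have hm := dotProduct_star_self_ne_zero hk
  have e1 : midPart l k ⬝ᵥ star (midPart l k) =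
      k ⬝ᵥ star k - (l ⬝ᵥ k) * (star l ⬝ᵥ star k) / (l ⬝ᵥ star l) := by
    conv_lhs => rw [star_midPart, dotProduct_sub, dotProduct_smul, midPart_dotProduct_left hl]
    simp [midPart]
    ring
  rw [e1, star_midPart, midPart, dotProduct_comm k l]
  match_scalars
  all_goals field_simp
  ring

theorem isNullPair_star {l w : Fin 7 → ℂ} (h : IsNullPair l w) : IsNullPair (star l) (star w) where
  left := star_dotProduct_star_eq_zero h.left
  mid := star_dotProduct_star_eq_zero h.mid
  right := star_dotProduct_star_eq_zero h.right
  cross := by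
    have := map_cross_comp (starRingEnd ℂ) l w
    rw [h.cross] at this
    refine this.symm.trans ?_
    ext i; simp

/-- Symmetry of the pair condition. By `smul_midPart_swap` the product in question is a combination
of w × w̄ and l × l̄, which `IsNullPair.swap_identity` for (l, w) and (l̄, w̄) shows to cancel. -/
theorem cross_midPart_symm {l k : Fin 7 → ℂ} (hl : l ≠ 0) (hk : k ≠ 0) (h0 : l ⬝ᵥ l = 0)
    (k0 : k ⬝ᵥ k = 0) (h : k ⬝ᵥ star l = 0) (hc : cross l (midPart l k) = 0) :
    cross k (midPart k l) = 0 := by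
  have hn := dotProduct_star_self_ne_zero hl
  have hm := dotProduct_star_self_ne_zero hk
  have hN : IsNullPair l (midPart l k) :=
    ⟨h0, by rw [dotProduct_comm, midPart_dotProduct_left hl], midPart_dotProduct_self h0 k0 h, hc⟩
  have hN' := isNullPair_star hN
  have hs := hN.swap_identity (IsUnit.mk0 (2 : ℂ) two_ne_zero) hN'
    (star_midPart_dotProduct h0 h) (midPart_dotProduct_star h0 h)
  have e := smul_midPart_swap hl hk
  refine (smul_eq_zero.mp ?_).resolve_left hm
  have ek : ∀ z, cross k z = cross (midPart l k) z +
      ((l ⬝ᵥ k) / (l ⬝ᵥ star l)) • cross (star l) z := fun z => by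
    conv_lhs => rw [midPart_eq l k]
    rw [cross_add_left, cross_smul_left]
  rw [← cross_smul_right, e, ek]
  simp only [cross_sub_right, cross_smul_right, hN.symm.cross,
    hN'.cross, cross_swap (star l) l, cross_swap (midPart l k) (star (midPart l k))]
  have ha : (l ⬝ᵥ k) / (l ⬝ᵥ star l) * (l ⬝ᵥ star l) = l ⬝ᵥ k := div_mul_cancel₀ _ hn
  have hc' : (l ⬝ᵥ k) • cross (star (midPart l k)) (midPart l k) =
      ((l ⬝ᵥ k) / (l ⬝ᵥ star l)) • (midPart l k ⬝ᵥ star (midPart l k)) • cross l (star l) := by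
    rw [hs, smul_smul, ha]
  linear_combination (norm := module) hc'

theorem midPart_symm_eq_zero {l k : Fin 7 → ℂ} (hl : l ≠ 0) (hk : k ≠ 0)
    (hw : midPart l k = 0) : midPart k l = 0 := by
  have e := smul_midPart_swap hl hk
  rw [hw] at e
  simp only [star_zero, dotProduct_zero, zero_smul, smul_zero, sub_zero] at e
  exact (smul_eq_zero.mp e).resolve_left (dotProduct_star_self_ne_zero hk)

/-- Witnesses that the residue is nonzero as soon as the middle part is: this gives both the genuine
pole and the nondegeneracy of the new pair. -/
theorem pairRes_mulVec {l k : Fin 7 → ℂ} (hk : k ≠ 0) (k0 : k ⬝ᵥ k = 0) (h : k ⬝ᵥ star l = 0) :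
    pairRes l k *ᵥ star k = star (midPart l k) := by
  have hm := dotProduct_star_self_ne_zero hk
  simp [pairRes, add_mulVec, smul_mulVec, vecMulVec_mulVec, smul_smul, hm,
    midPart_dotProduct_star k0 (dotProduct_star_eq_zero_comm h)]

theorem pairRes_transpose_mulVec (l k q : Fin 7 → ℂ) :
    (pairRes l k)ᵀ *ᵥ q = ((l ⬝ᵥ star l)⁻¹ * (star l ⬝ᵥ q)) • midPart k l +
      ((k ⬝ᵥ star k)⁻¹ * (star (midPart l k) ⬝ᵥ q)) • k := by
  simp [pairRes, add_mulVec, smul_mulVec, vecMulVec_mulVec, smul_smul, transpose_vecMulVec]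

theorem pairRes_transpose_mulVec_left {l k : Fin 7 → ℂ} (hl : l ≠ 0) (h0 : l ⬝ᵥ l = 0)
    (h : k ⬝ᵥ star l = 0) : (pairRes l k)ᵀ *ᵥ l = midPart k l := by
  have hn := dotProduct_star_self_ne_zero hl
  rw [pairRes_transpose_mulVec, dotProduct_comm _ l, dotProduct_comm _ l,
    star_midPart_dotProduct h0 h]
  simp [hn]

/-! ### The pair element as a loop in `𝔾₂` -/

theorem IsNullPair.constVec {l w : Fin 7 → ℂ} (h : IsNullPair l w) :
    IsNullPair (constVec l) (constVec w) where
  left := by rw [constVec_dotProduct, h.left, map_zero]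
  mid := by rw [constVec_dotProduct, h.mid, map_zero]
  right := by rw [constVec_dotProduct, h.right, map_zero]
  cross := by
    rw [G2Loop.constVec, G2Loop.constVec, ← map_cross_comp, h.cross]
    ext i; simp

theorem constVec_add_smul (x y : Fin 7 → ℂ) (a : ℂ) :
    constVec (x + a • y) = constVec x + RatFunc.C a • constVec y := by
  ext i; simp [constVec]

theorem isOctAut_pair (α : ℂ) {l k : Fin 7 → ℂ} (h : IsG2VecPair l k) :
    IsOctAut (simpleVec α l * simpleVec α k) := by
  have hN := h.isNullPair
  have hN' := isNullPair_star hN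
  have h2 : (2 : RatFunc ℂ) ≠ 0 := by
    rw [show (2 : RatFunc ℂ) = RatFunc.C 2 from (map_ofNat RatFunc.C 2).symm]
    exact (map_ne_zero _).mpr two_ne_zero
  have key := isOctAut_simpleMat_mul h2 (moeb_ne_zero α) hN.constVec hN'.constVec
    (a := RatFunc.C ((l ⬝ᵥ k) / (l ⬝ᵥ star l)))
    (a' := RatFunc.C ((star l ⬝ᵥ star k) / (l ⬝ᵥ star l)))
    (by rw [constVec_dotProduct]
        exact (map_ne_zero _).mpr (dotProduct_star_self_ne_zero h.left_ne))
    (by rw [constVec_dotProduct]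
        exact (map_ne_zero _).mpr (dotProduct_star_self_ne_zero h.mid_ne))
    (by rw [constVec_dotProduct, star_midPart_dotProduct h.left_null h.perp, map_zero])
    (by rw [constVec_dotProduct, dotProduct_comm, midPart_dotProduct_star h.left_null h.perp,
      map_zero])
  rw [← constVec_add_smul, ← constVec_add_smul, ← midPart_eq, ← star_eq_star_midPart,
    constVec_dotProduct] at key
  exact key ((map_ne_zero _).mpr (dotProduct_star_self_ne_zero h.right_ne))

theorem ratConj_moeb (α : ℂ) : ratConj (moeb α) = (moeb α)⁻¹ := by
  rw [moeb, map_div₀, map_sub, map_sub, ratConj_X, ratConj_C, ratConj_C, Complex.conj_conj, inv_div]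

theorem ratConj_comp_constVec (l : Fin 7 → ℂ) : ratConj ∘ constVec l = constVec (star l) := by
  ext i; simp [constVec, ratConj_C]

/-- Conjugation exchanges μ with μ⁻¹ and l with l̄, so the two rank-one terms trade places. -/
theorem simpleVec_map_ratConj (α : ℂ) (l : Fin 7 → ℂ) :
    (simpleVec α l).map ratConj = simpleVec α l := by
  have e1 : ∀ i, ratConj (constVec l i) = constVec (star l) i :=
    congrFun (ratConj_comp_constVec l)
  have e2 : ∀ i, ratConj (constVec (star l) i) = constVec l i := fun i => by
    simpa using congrFun (ratConj_comp_constVec (star l)) i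
  have e3 : ratConj (constVec l ⬝ᵥ constVec (star l)) = constVec l ⬝ᵥ constVec (star l) := by
    rw [constVec_dotProduct, ratConj_C]
    congr 1
    change star (l ⬝ᵥ star l) = _
    rw [← star_dotProduct_star, star_star]
  ext i j
  simp only [simpleVec, simpleMat, Matrix.map_apply, Matrix.add_apply, Matrix.smul_apply,
    smul_eq_mul, vecMulVec_apply, map_add, map_mul, map_div₀, map_sub, map_inv₀, map_one,
    ratConj_moeb, e1, e2, e3, inv_inv]
  have : ratConj ((1 : RatMat) i j) = (1 : RatMat) i j := by
    by_cases h : i = j <;> simp [Matrix.one_apply, h]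
  rw [this]
  ring

theorem tendsto_eval_add {f g : RatFunc ℂ} {a b : ℂ}
    (hf : Tendsto (fun z => f.eval (RingHom.id ℂ) z) (Bornology.cobounded ℂ) (nhds a))
    (hg : Tendsto (fun z => g.eval (RingHom.id ℂ) z) (Bornology.cobounded ℂ) (nhds b)) :
    Tendsto (fun z => (f + g).eval (RingHom.id ℂ) z) (Bornology.cobounded ℂ) (nhds (a + b)) := by
  refine (hf.add hg).congr' ?_
  filter_upwards [eventually_mem_localRing f, eventually_mem_localRing g] with z h1 h2
  exact (RatFunc.eval_add _ _ h1 h2).symm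

theorem tendsto_eval_mul {f g : RatFunc ℂ} {a b : ℂ}
    (hf : Tendsto (fun z => f.eval (RingHom.id ℂ) z) (Bornology.cobounded ℂ) (nhds a))
    (hg : Tendsto (fun z => g.eval (RingHom.id ℂ) z) (Bornology.cobounded ℂ) (nhds b)) :
    Tendsto (fun z => (f * g).eval (RingHom.id ℂ) z) (Bornology.cobounded ℂ) (nhds (a * b)) := by
  refine (hf.mul hg).congr' ?_
  filter_upwards [eventually_mem_localRing f, eventually_mem_localRing g] with z h1 h2
  exact (RatFunc.eval_mul _ _ h1 h2).symm

theorem tendsto_eval_C (c : ℂ) :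
    Tendsto (fun z => (RatFunc.C c).eval (RingHom.id ℂ) z) (Bornology.cobounded ℂ) (nhds c) := by
  simp

theorem tendsto_eval_X_sub_C_div (a b : ℂ) :
    Tendsto (fun z => ((RatFunc.X - RatFunc.C a) / (RatFunc.X - RatFunc.C b) : RatFunc ℂ).eval
      (RingHom.id ℂ) z) (Bornology.cobounded ℂ) (nhds 1) := by
  have h1 : Tendsto (fun z : ℂ => 1 + (b - a) * (z - b)⁻¹) (Bornology.cobounded ℂ) (nhds 1) := by
    have h2 : Tendsto (fun z : ℂ => (z - b)⁻¹) (Bornology.cobounded ℂ) (nhds 0) :=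
      tendsto_inv₀_cobounded.comp (tendsto_sub_const_cobounded b)
    simpa using (h2.const_mul (b - a)).const_add 1
  refine h1.congr' ?_
  have h3 : ∀ᶠ z in Bornology.cobounded ℂ, z ∉ ({b} : Set ℂ) := by
    have := (Set.finite_singleton b).isBounded
    rwa [Bornology.isBounded_def] at this
  filter_upwards [h3] with z hz
  have hz' : z - b ≠ 0 := sub_ne_zero.mpr hz
  have e : ∀ c : ℂ, (RatFunc.X - RatFunc.C c : RatFunc ℂ) =
      algebraMap (Polynomial ℂ) _ (Polynomial.X - Polynomial.C c) := fun c => by simp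
  rw [e, e, eval_div _ (by simpa using hz')]
  simp only [Polynomial.eval_sub, Polynomial.eval_X, Polynomial.eval_C]
  field_simp
  ring

theorem tendsto_value_simpleVec (α : ℂ) (l : Fin 7 → ℂ) :
    Tendsto (value (simpleVec α l)) (Bornology.cobounded ℂ) (nhds 1) := by
  have hm := tendsto_eval_X_sub_C_div α (starRingEnd ℂ α)
  have hm' := tendsto_eval_X_sub_C_div (starRingEnd ℂ α) α
  rw [← moeb] at hm
  rw [← inv_div, ← moeb] at hm'
  refine tendsto_pi_nhds.mpr fun i => tendsto_pi_nhds.mpr fun j => ?_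
  have e : simpleVec α l i j = RatFunc.C ((1 : Mat7) i j - conjProj l i j - (conjProj l)ᵀ i j) +
      moeb α * RatFunc.C ((conjProj l)ᵀ i j) + (moeb α)⁻¹ * RatFunc.C (conjProj l i j) := by
    rw [simpleVec_eq]; rfl
  change Tendsto (fun z => (simpleVec α l i j).eval (RingHom.id ℂ) z) _ _
  rw [e]
  convert tendsto_eval_add (tendsto_eval_add (tendsto_eval_C _)
    (tendsto_eval_mul hm (tendsto_eval_C _))) (tendsto_eval_mul hm' (tendsto_eval_C _)) using 2
  ring

theorem isAlgLoop_pair (α : ℂ) {l k : Fin 7 → ℂ} (h : IsG2VecPair l k) :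
    IsAlgLoop (simpleVec α l * simpleVec α k) where
  aut := isOctAut_pair α h
  real := by rw [Matrix.map_mul, simpleVec_map_ratConj, simpleVec_map_ratConj]
  neg := tendsto_value_mul (tendsto_value_simpleVec α l) (tendsto_value_simpleVec α k)

theorem regularAt_conj_iff {g : RatMat} (hg : g.map ratConj = g) {z : ℂ} :
    RegularAt g (starRingEnd ℂ z) ↔ RegularAt g z := by
  constructor <;> intro h <;> have := h.conj <;> rw [hg] at this
  · rwa [Complex.conj_conj] at this
  · exact this

theorem hasSimplePoleAt_pair {α : ℂ} (hα : α.im ≠ 0) {l k : Fin 7 → ℂ} (h : IsG2VecPair l k) :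
    HasSimplePoleAt (simpleVec α l * simpleVec α k) α := by
  obtain ⟨h1, h2⟩ := X_sub_C_smul_pair hα h.perp
  refine ⟨fun hr => ?_, h1⟩
  rw [value_smul (X_sub_C_mem_localRing α α) hr, eval_X_sub_C, sub_self, zero_smul] at h2
  have h3 := (smul_eq_zero.mp h2.symm).resolve_left (sub_conj_ne_zero hα)
  have h4 := pairRes_mulVec h.right_ne h.right_null h.perp
  rw [h3, zero_mulVec] at h4
  exact h.mid_ne (star_eq_zero.mp h4.symm)

theorem HasSimplePoleAt.conj {g : RatMat} (hg : g.map ratConj = g) {z : ℂ}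
    (h : HasSimplePoleAt g z) : HasSimplePoleAt g (starRingEnd ℂ z) := by
  refine ⟨fun hr => h.1 ((regularAt_conj_iff hg).mp hr), ?_⟩
  have := h.2.conj
  have e : ((RatFunc.X - RatFunc.C z : RatFunc ℂ) • g).map ratConj =
      (RatFunc.X - RatFunc.C (starRingEnd ℂ z) : RatFunc ℂ) • g.map ratConj := by
    ext i j
    simp [ratConj_X, ratConj_C]
  rwa [e, hg] at this

/-! ### Dressing by simple elements -/

theorem inv_eq_transpose_of_orth {R : Type*} [CommRing R] {A : Matrix (Fin 7) (Fin 7) R}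
    (h : Aᵀ * A = 1) : A⁻¹ = Aᵀ := Matrix.inv_eq_left_inv h

theorem orth_mul {R : Type*} [CommRing R] {A B : Matrix (Fin 7) (Fin 7) R}
    (hA : Aᵀ * A = 1) (hB : Bᵀ * B = 1) : (A * B)ᵀ * (A * B) = 1 := by
  rw [transpose_mul, Matrix.mul_assoc, ← Matrix.mul_assoc Aᵀ, hA, Matrix.one_mul, hB]

theorem orth_transpose {R : Type*} [CommRing R] {A : Matrix (Fin 7) (Fin 7) R}
    (hA : Aᵀ * A = 1) : Aᵀᵀ * Aᵀ = 1 := by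
  rw [transpose_transpose]; exact mul_eq_one_comm.mp hA

/-- The spanning vector of `h(α)⁻¹ L`. -/
noncomputable def pullVec (α : ℂ) (h : RatMat) (l : Fin 7 → ℂ) : Fin 7 → ℂ :=
  (value h α)ᵀ *ᵥ l

section Pull

variable {α : ℂ} {h : RatMat}

theorem pullLine_line (ho : hᵀ * h = 1) (hr : RegularAt h α) (l : Fin 7 → ℂ) :
    pullLine α h (line l) = line (pullVec α h l) := by
  rw [pullLine, map_act_line, pullVec, inv_eq_transpose_of_orth (value_orth ho hr)]

theorem value_mulVec_pullVec (ho : hᵀ * h = 1) (hr : RegularAt h α) (l : Fin 7 → ℂ) :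
    value h α *ᵥ pullVec α h l = l := by
  rw [pullVec, mulVec_mulVec, mul_eq_one_comm.mp (value_orth ho hr), one_mulVec]

theorem pullVec_ne_zero (ho : hᵀ * h = 1) (hr : RegularAt h α) {l : Fin 7 → ℂ} (hl : l ≠ 0) :
    pullVec α h l ≠ 0 := fun h0 => hl (by
  rw [← value_mulVec_pullVec ho hr l, h0, mulVec_zero])

theorem pullVec_null (ho : hᵀ * h = 1) (hr : RegularAt h α) {l : Fin 7 → ℂ} (h0 : l ⬝ᵥ l = 0) :
    pullVec α h l ⬝ᵥ pullVec α h l = 0 := by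
  rw [pullVec, transpose_mul_eq_one_iff.mp (orth_transpose (value_orth ho hr)), h0]

end Pull

/-- The dressed loop `p_k h p_{k'}⁻¹` for a spanning vector `k`. -/
noncomputable def dressVec (α : ℂ) (k : Fin 7 → ℂ) (h : RatMat) : RatMat :=
  simpleVec α k * h * (simpleVec α (pullVec α h k))ᵀ

section Dress

variable {α : ℂ} {h : RatMat} {k : Fin 7 → ℂ}

theorem dressVec_orth (ho : hᵀ * h = 1) (hr : RegularAt h α) (hk : k ≠ 0) (k0 : k ⬝ᵥ k = 0) :
    (dressVec α k h)ᵀ * dressVec α k h = 1 :=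
  orth_mul (orth_mul (simpleVec_orth α hk k0) ho)
    (orth_transpose (simpleVec_orth α (pullVec_ne_zero ho hr hk) (pullVec_null ho hr k0)))

theorem regularAt_dressVec (hα : α.im ≠ 0) (ho : hᵀ * h = 1) (hr : RegularAt h α) (hk : k ≠ 0)
    (k0 : k ⬝ᵥ k = 0) : RegularAt (dressVec α k h) α :=
  regularAt_dressing hα ho hr (pullVec_ne_zero ho hr hk) (pullVec_null ho hr k0) hk k0
    (value_mulVec_pullVec ho hr k)

theorem det_dressVec (ho : hᵀ * h = 1) (hr : RegularAt h α) (hd : h.det = 1) (hk : k ≠ 0)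
    (k0 : k ⬝ᵥ k = 0) : (dressVec α k h).det = 1 := by
  rw [dressVec, det_mul, det_mul, det_transpose, det_simpleVec α hk k0, hd,
    det_simpleVec α (pullVec_ne_zero ho hr hk) (pullVec_null ho hr k0), one_mul, one_mul]

theorem holomorphicAt_dressVec (hα : α.im ≠ 0) (ho : hᵀ * h = 1) (hr : RegularAt h α)
    (hd : h.det = 1) (hk : k ≠ 0) (k0 : k ⬝ᵥ k = 0) :
    HolomorphicAt SO7 (dressVec α k h) α := by
  have hreg := regularAt_dressVec hα ho hr hk k0
  refine ⟨hreg, value_orth (dressVec_orth ho hr hk k0) hreg, ?_⟩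
  rw [(det_value hreg).2, det_dressVec ho hr hd hk k0, RatFunc.eval_one]

theorem dress_line (ho : hᵀ * h = 1) (hr : RegularAt h α) (hk : k ≠ 0) (k0 : k ⬝ᵥ k = 0) :
    dress α (line k) h = dressVec α k h := by
  have hk' := pullVec_ne_zero ho hr hk
  have k0' := pullVec_null ho hr k0
  rw [dress, pullLine_line ho hr, simpleElt_line α hk k0, simpleElt_line α hk' k0', ← simpleVec,
    ← simpleVec, inv_eq_transpose_of_orth (simpleVec_orth α hk' k0'), dressVec]

/-- Dressing by k and then by l is dressing by the pair, so two uses of `regularAt_dressVec` make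
the pair-dressed loop regular without information on the new pair. -/
theorem dressVec_dressVec (α : ℂ) (l k : Fin 7 → ℂ) (h : RatMat) :
    dressVec α l (dressVec α k h) = simpleVec α l * simpleVec α k * h *
      (simpleVec α (pullVec α (dressVec α k h) l) * simpleVec α (pullVec α h k))ᵀ := by
  rw [dressVec, transpose_mul]
  conv_lhs => enter [1, 2]; rw [dressVec]
  simp only [Matrix.mul_assoc]

end Dress

/-- If a loop in `𝔾₂` is conjugated by products of two simple elements into a regular orthogonal
loop, then the pair condition is inherited. -/
theorem IsG2VecPair.of_regularAt {α : ℂ} (hα : α.im ≠ 0) {l k l' k' : Fin 7 → ℂ}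
    (hp : IsG2VecPair l k) {h f : RatMat} (hh : IsOctAut h) (hr : RegularAt h α)
    (hfo : fᵀ * f = 1) (hfr : RegularAt f α)
    (hl' : l' ≠ 0) (l0' : l' ⬝ᵥ l' = 0) (hk' : k' ≠ 0) (k0' : k' ⬝ᵥ k' = 0)
    (hkk : k' = (value h α)ᵀ *ᵥ k)
    (hf : f = simpleVec α l * simpleVec α k * h * (simpleVec α l' * simpleVec α k')ᵀ) :
    IsG2VecPair l' k' := by
  have ho' := orth_mul (simpleVec_orth α hl' l0') (simpleVec_orth α hk' k0')
  have e : simpleVec α l' * simpleVec α k' = fᵀ * (simpleVec α l * simpleVec α k) * h := by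
    have h1 : f * (simpleVec α l' * simpleVec α k') = simpleVec α l * simpleVec α k * h := by
      rw [hf, Matrix.mul_assoc, ho', Matrix.mul_one]
    rw [Matrix.mul_assoc, ← h1, ← Matrix.mul_assoc, hfo, Matrix.one_mul]
  have e' : (RatFunc.X - RatFunc.C α : RatFunc ℂ) • (simpleVec α l' * simpleVec α k') =
      fᵀ * ((RatFunc.X - RatFunc.C α : RatFunc ℂ) • (simpleVec α l * simpleVec α k)) * h := by
    rw [e, Matrix.mul_smul, Matrix.smul_mul]
  obtain ⟨r1, r2⟩ := X_sub_C_smul_pair hα hp.perp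
  have r3 : RegularAt ((RatFunc.X - RatFunc.C α : RatFunc ℂ) •
      (simpleVec α l' * simpleVec α k')) α := by
    rw [e']; exact (hfr.transpose.mul r1).mul hr
  have hperp := dotProduct_star_eq_zero_of_regularAt hα hl' hk' r3
  have hs := sub_conj_ne_zero hα
  -- Compare the values at α of λ − α times both sides; the common factor α − ᾱ is nonzero.
  have hres : pairRes l' k' = (value f α)ᵀ * pairRes l k * value h α := by
    have r4 := (X_sub_C_smul_pair hα hperp).2
    rw [e', value_mul (hfr.transpose.mul r1) hr, value_mul hfr.transpose r1, r2, value_transpose,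
      Matrix.mul_smul, Matrix.smul_mul] at r4
    exact (smul_right_injective _ hs r4).symm
  have hval := hh.value hr
  have hvalT := hval.transpose
  refine ⟨hl', hk', l0', k0', hperp, fun hw => ?_, ?_⟩
  -- A zero middle part would make the new residue vanish, and with it the residue of (l, k), since
  -- f(α) and h(α) are invertible.
  · have hres0 : pairRes l' k' = 0 := by
      rw [pairRes, hw, midPart_symm_eq_zero hl' hk' hw]; simp
    have h1 : pairRes l k = value f α * pairRes l' k' * (value h α)ᵀ := by
      have e1 := mul_eq_one_comm.mp (value_orth hfo hfr)
      have e2 := mul_eq_one_comm.mp hval.orth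
      rw [hres, Matrix.mul_assoc, Matrix.mul_assoc _ (value h α), e2, Matrix.mul_one,
        ← Matrix.mul_assoc, e1, Matrix.one_mul]
    rw [hres0, Matrix.mul_zero, Matrix.zero_mul] at h1
    have h4 := pairRes_mulVec hp.right_ne hp.right_null hp.perp
    rw [h1, zero_mulVec] at h4
    exact hp.mid_ne (star_eq_zero.mp h4.symm)
  -- The row space is used because only h(α)ᵀ, an automorphism, acts on it: the middle part of l'
  -- relative to k' is the image of a combination of k and `midPart k l`, and k' is the image of k.
  -- The vector f(α) l' enters only through the coefficients.
  · refine cross_midPart_symm hk' hl' k0' l0' (dotProduct_star_eq_zero_comm hperp) ?_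
    rw [← pairRes_transpose_mulVec_left hl' l0' hperp, hres, transpose_mul, transpose_mul,
      transpose_transpose, ← mulVec_mulVec, ← mulVec_mulVec, hkk, ← hvalT.map_cross,
      pairRes_transpose_mulVec, cross_add_right, cross_smul_right, cross_smul_right, cross_self,
      cross_midPart_symm hp.left_ne hp.right_ne hp.left_null hp.right_null hp.perp hp.cross]
    simp

end G2Loop

/-! ### Proof of the proposition -/

open G2Loop
theorem mainTheorem9 (α : ℂ) (hα : α.im ≠ 0)
    (L K : Submodule ℂ C7) (hLK : IsG2Pair L K)
    (h : RatMat) (hloop : IsNegRealLoop G2 h) (hhol : HolomorphicAt G2 h α)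
    (K' L' : Submodule ℂ C7) (hK' : K' = pullLine α h K)
    (hL' : L' = pullLine α (dress α K h) L) :
    HolomorphicAt SO7 (dress α K h) α ∧
    IsG2Pair L' K' ∧
    IsNegRealLoop G2 (pairElt α L' K') ∧
    HasSimplePoleAt (pairElt α L' K') α ∧
    HasSimplePoleAt (pairElt α L' K') (starRingEnd ℂ α) ∧
    IsNegRealLoop G2 (pairElt α L K * h * (pairElt α L' K')⁻¹) ∧
    HolomorphicAt G2 (pairElt α L K * h * (pairElt α L' K')⁻¹) α ∧
    HolomorphicAt G2 (pairElt α L K * h * (pairElt α L' K')⁻¹) (starRingEnd ℂ α) := by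
  obtain ⟨l, hl, l0, rfl⟩ := isIsotropicLine_iff.mp hLK.left_line
  obtain ⟨k, hk, k0, rfl⟩ := isIsotropicLine_iff.mp hLK.right_line
  have hp := (isG2Pair_line_iff hl hk l0 k0).mp hLK
  have hA := hloop.isAlgLoop
  have ho := hA.aut.orth
  have hr := hhol.1
  have hdet := det_eq_one_of_tendsto ho hA.neg
  have hk' := pullVec_ne_zero ho hr hk
  have k0' := pullVec_null ho hr k0
  have go := dressVec_orth ho hr hk k0
  have gr := regularAt_dressVec hα ho hr hk k0
  have hl' := pullVec_ne_zero go gr hl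
  have l0' := pullVec_null go gr l0
  have fo := dressVec_orth go gr hl l0
  have fr := regularAt_dressVec hα go gr hl l0
  rw [dress_line ho hr hk k0, pullLine_line go gr] at hL'
  rw [pullLine_line ho hr] at hK'
  have hf := dressVec_dressVec α l k h
  rw [dress_line ho hr hk k0]
  subst hL' hK'
  have hp' := hp.of_regularAt hα hA.aut hr fo fr hl' l0' hk' k0' rfl hf
  have hA' := isAlgLoop_pair α hp'
  have hpole := hasSimplePoleAt_pair hα hp'
  -- Only now, with the pair condition for (L', K') established, is the dressed loop a product of
  -- three loops in G₂.
  have hF : IsAlgLoop (dressVec α l (dressVec α k h)) := by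
    rw [hf]
    exact ((isAlgLoop_pair α hp).mul hA).mul hA'.transpose
  have eP : pairElt α (line l) (line k) = simpleVec α l * simpleVec α k := by
    rw [pairElt, simpleElt_line α hl l0, simpleElt_line α hk k0]; rfl
  have eP' : pairElt α (line (pullVec α (dressVec α k h) l)) (line (pullVec α h k)) =
      simpleVec α (pullVec α (dressVec α k h) l) * simpleVec α (pullVec α h k) := by
    rw [pairElt, simpleElt_line α hl' l0', simpleElt_line α hk' k0']; rfl
  rw [eP, eP', inv_eq_transpose_of_orth hA'.aut.orth, ← hf]
  exact ⟨holomorphicAt_dressVec hα ho hr hdet hk k0,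
    (isG2Pair_line_iff hl' hk' l0' k0').mpr hp', hA'.isNegRealLoop, hpole, hpole.conj hA'.real,
    hF.isNegRealLoop, hF.aut.holomorphicAt fr,
    hF.aut.holomorphicAt ((regularAt_conj_iff hF.real).mpr fr)⟩
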